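/- Let $k$ be a field, let $X=X_0\cup X_1$ be a well-ordered set, divided into letters of parity $0$ and letters of parity $1$ ($X_0\cap X_1=\emptyset$), and let $\deg:X\to\mathbb Z_{>0}$ be a map. Let $\mathrm{Lbs}(X)$ be the free Leibniz superalgebra over $k$ generated by $X$, that is, the quotient of the free non-associative $k$-algebra on $X$ by the ideal generated by all $(\mu(\nu\tau))-((\mu\nu)\tau)+(-1)^{|\nu||\tau|}((\mu\tau)\nu)$, where $\mu,\nu,\tau$ are non-associative words in $X$ and the parity $|\cdot|\in\mathbb Z/2$ of a word is the sum of the parities of its letters. Write $[f_1\cdots f_n]_L=((\cdots((f_1f_2)f_3)\cdots)f_n)$. The set $NF(X)=\{[a_1\cdots a_n]_L: n\ge 1,\ a_i\in X\}$ is a linear basis of $\mathrm{Lbs}(X)$; for $\mu=[a_1\cdots a_n]_L$ put $\deg\mu=\sum_i\deg a_i$, $\ell(\mu)=n$, $|\mu|=\sum_i|a_i|$, and order $NF(X)$ by comparing the sequences $(\deg\mu,\ell(\mu),a_1,\dots,a_n)$ lexicographically (the deg-length-lex order). For $f\neq 0$ let $\bar f$ be the greatest element of $NF(X)$ that occurs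 in $f$; $f$ is monic if $\bar f$ has coefficient $1$ in $f$, and homogeneous if all elements of $NF(X)$ occurring in $f$ have the same parity. Let $S\subseteq \mathrm{Lbs}(X)$ be a nonempty set of monic homogeneous elements and let $\mathrm{Id}(S)$ be the (graded) ideal of $\mathrm{Lbs}(X)$ generated by $S$. For $s\in S$, the normal $s$-polynomials are the elements $[s\,a_1\cdots a_m]_L$ with $m\ge 0$, $a_i\in X$, and, if $\ell(\bar s)=1$, also the elements $[a_1\cdots a_t\,s\,a_{t+1}\cdots a_m]_L$ with $1\le t\le m$, $a_i\in X$; a normal $S$-polynomial is a normal $s$-polynomial for some $s\in S$. Let $\mathrm{Irr}(S)$ be the set of all $\mu\in NF(X)$ such that $\mu\ne\bar h$ for every normal $S$-polynomial $h$. The set $S$ is called a Gröbner–Shirshov basis if the following two conditions hold: (a) for all $f\in S$ and $\mu\in NF(X)$ with $\ell(\bar f)>1$ and $(\mu f)\ne 0$, the left multiplication composition $(\mu f)$ is a linear combination of normal $S$-polynomials $h$ with $\deg\bar h\le\deg\mu+\deg\bar f$; (b) for all $f\neq g$ in $S$ and every normal $g$-polynomial $h$ with $\bar f=\bar h$, the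 inclusion composition $f-h$ is a linear combination of normal $S$-polynomials $h'$ with $\bar{h'}<\bar f$. Then the following are equivalent: (i) $S$ is a Gröbner–Shirshov basis; (ii) for every nonzero $f\in\mathrm{Id}(S)$ there is a normal $S$-polynomial $h$ with $\bar f=\bar h$; (iii) $\mathrm{Irr}(S)$ is a linear basis of $\mathrm{Lbs}(X)/\mathrm{Id}(S)$, i.e. the cosets $\mu+\mathrm{Id}(S)$, $\mu\in\mathrm{Irr}(S)$, are linearly independent and span the quotient. -/

import Mathlib

namespace LeibnizSuper

noncomputable section

/-! ### Ideals of (non-unital, non-associative) algebras -/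

section Ideals

variable {k A : Type*} [Field k] [NonUnitalNonAssocRing A] [Module k A]

/-- A linear subspace `I` of an algebra `A` is an ideal if `x * y` and `y * x` lie in `I`
for all `x` in `A` and `y` in `I`. -/
def IsIdeal (I : Submodule k A) : Prop :=
  ∀ x : A, ∀ y ∈ I, x * y ∈ I ∧ y * x ∈ I

variable (k) in
/-- The ideal `Id(S)` of the algebra `A` generated by `S`: the smallest ideal containing `S`. -/
def idealSpan (S : Set A) : Submodule k A :=
  sInf {I : Submodule k A | IsIdeal I ∧ S ⊆ I}

theorem idealSpan_isIdeal (S : Set A) : IsIdeal (idealSpan k S) := by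
  intro x y hy
  simp only [idealSpan, Submodule.mem_sInf, Set.mem_ofPred_eq] at hy ⊢
  exact ⟨fun I hI => (hI.1 x y (hy I hI)).1, fun I hI => (hI.1 x y (hy I hI)).2⟩

theorem subset_idealSpan (S : Set A) : S ⊆ idealSpan k S := by
  intro x hx
  simp only [idealSpan, SetLike.mem_coe, Submodule.mem_sInf, Set.mem_ofPred_eq]
  exact fun I hI => hI.2 hx

theorem idealSpan_le {S : Set A} {I : Submodule k A} (hI : IsIdeal I) (hS : S ⊆ I) :
    idealSpan k S ≤ I :=
  sInf_le ⟨hI, hS⟩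

end Ideals

/-! ### The free Leibniz superalgebra

Terms over `X` ("words with brackets") are the elements of `FreeMagma X`, the free
non-associative algebra `kX**` is `FreeNonUnitalNonAssocAlgebra k X`. The decomposition
`X = X₀ ∪ X₁` is given by the parity function `par : X → ZMod 2`. -/

section Free

variable {X : Type*}

/-- The parity of a term: the sum modulo 2 of the parities of its letters. -/
def termParity (par : X → ZMod 2) : FreeMagma X → ZMod 2
  | .of x => par x
  | .mul μ ν => termParity par μ + termParity par ν

/-- The sign `(-1) ^ (i * j)` for parities `i`, `j`. -/
def sgn (k : Type*) [Field k] (i j : ZMod 2) : k := (-1) ^ (i.val * j.val)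

/-- A term, as an element of the free non-associative algebra. -/
def term (k : Type*) [Field k] (μ : FreeMagma X) : FreeNonUnitalNonAssocAlgebra k X :=
  MonoidAlgebra.single μ 1

/-- The elements `(μ(ντ)) - ((μν)τ) + (-1)^{|ν||τ|} ((μτ)ν)` for terms `μ`, `ν`, `τ`. -/
def leibnizRelations (k : Type*) [Field k] (par : X → ZMod 2) :
    Set (FreeNonUnitalNonAssocAlgebra k X) :=
  {f | ∃ μ ν τ : FreeMagma X,
    f = term k μ * (term k ν * term k τ) - (term k μ * term k ν) * term k τ
      + sgn k (termParity par ν) (termParity par τ) • ((term k μ * term k τ) * term k ν)}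

/-- The free Leibniz superalgebra `Lbs(X)` over `k` generated by `X = X₀ ∪ X₁`: the quotient of
the free non-associative algebra by the ideal generated by the Leibniz superidentities. -/
def Lbs (k : Type*) [Field k] (par : X → ZMod 2) : Type _ :=
  FreeNonUnitalNonAssocAlgebra k X ⧸ idealSpan k (leibnizRelations k par)

namespace Lbs

variable {k : Type*} [Field k] {par : X → ZMod 2}

instance : AddCommGroup (Lbs k par) :=
  inferInstanceAs (AddCommGroup (_ ⧸ idealSpan k (leibnizRelations k par)))

instance : Module k (Lbs k par) :=
  inferInstanceAs (Module k (_ ⧸ idealSpan k (leibnizRelations k par)))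

variable (k par) in
/-- The quotient map. -/
def proj : FreeNonUnitalNonAssocAlgebra k X →ₗ[k] Lbs k par :=
  (idealSpan k (leibnizRelations k par)).mkQ

theorem proj_surjective : Function.Surjective (proj k par) :=
  Submodule.mkQ_surjective _

theorem proj_eq_zero {f : FreeNonUnitalNonAssocAlgebra k X} :
    proj k par f = 0 ↔ f ∈ idealSpan k (leibnizRelations k par) :=
  Submodule.Quotient.mk_eq_zero _

variable (k par) in
/-- The product of the quotient algebra, as a bilinear map. -/
def mulMap : Lbs k par →ₗ[k] Lbs k par →ₗ[k] Lbs k par :=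
  (idealSpan k (leibnizRelations k par)).liftQ
    (LinearMap.flip ((idealSpan k (leibnizRelations k par)).liftQ
      (LinearMap.flip ((LinearMap.mul k (FreeNonUnitalNonAssocAlgebra k X)).compr₂ (proj k par)))
      (by
        intro y hy
        rw [LinearMap.mem_ker]
        refine LinearMap.ext fun x => ?_
        exact proj_eq_zero.2 (idealSpan_isIdeal _ (x : FreeNonUnitalNonAssocAlgebra k X) y hy).1)))
    (by
      intro y hy
      rw [LinearMap.mem_ker]
      ext1 x
      obtain ⟨x, rfl⟩ := proj_surjective x
      exact proj_eq_zero.2 (idealSpan_isIdeal _ x y hy).2)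

instance : NonUnitalNonAssocRing (Lbs k par) where
  mul f g := mulMap k par f g
  left_distrib f g h := map_add (mulMap k par f) g h
  right_distrib f g h := LinearMap.map_add₂ (mulMap k par) f g h
  zero_mul f := LinearMap.map_zero₂ (mulMap k par) f
  mul_zero f := map_zero (mulMap k par f)

instance : IsScalarTower k (Lbs k par) (Lbs k par) where
  smul_assoc c f g := LinearMap.map_smul₂ (mulMap k par) c f g

instance : SMulCommClass k (Lbs k par) (Lbs k par) where
  smul_comm c f g := (map_smul (mulMap k par f) c g).symm

theorem proj_mul (f g : FreeNonUnitalNonAssocAlgebra k X) :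
    proj k par (f * g) = proj k par f * proj k par g := rfl

variable (k par) in
/-- The image of a letter in the free Leibniz superalgebra. -/
def of (x : X) : Lbs k par := proj k par (term k (.of x))

/-- The element `[f a₁ ⋯ aₘ]_L = ((⋯((f a₁) a₂)⋯) aₘ)` for letters `a₁, …, aₘ`, `m ≥ 0`. -/
def mulLetters (f : Lbs k par) (l : List X) : Lbs k par :=
  l.foldl (fun g a => g * of k par a) f

variable (k par) in
/-- The left-normed monomial `[a₁ ⋯ aₙ]_L`, where `a₁ ⋯ aₙ`, `n ≥ 1`, is a nonempty word. -/
def leftNormed (w : FreeSemigroup X) : Lbs k par :=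
  mulLetters (of k par w.head) w.tail

/-! #### The left-normed monomials form a linear basis -/

theorem mulLetters_append (f : Lbs k par) (l l' : List X) :
    mulLetters f (l ++ l') = mulLetters (mulLetters f l) l' := by
  simp [mulLetters, List.foldl_append]

theorem leibniz_term (f : Lbs k par) (ν τ : FreeMagma X) :
    f * (proj k par (term k ν) * proj k par (term k τ)) =
      (f * proj k par (term k ν)) * proj k par (term k τ)
      - sgn k (termParity par ν) (termParity par τ) •
        ((f * proj k par (term k τ)) * proj k par (term k ν)) := by
  obtain ⟨f, rfl⟩ := proj_surjective f
  induction f using MonoidAlgebra.induction_linear with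
  | zero => simp
  | add f g hf hg => simp only [map_add, add_mul, hf, hg, smul_add]; abel
  | single μ c =>
    have h : (MonoidAlgebra.single μ c : FreeNonUnitalNonAssocAlgebra k X) = c • term k μ := by
      simp [term]
    have h0 := proj_eq_zero.2 (subset_idealSpan (k := k) (leibnizRelations k par)
      ⟨μ, ν, τ, rfl⟩)
    simp only [map_add, map_sub, map_smul, proj_mul] at h0
    rw [h]
    simp only [map_smul, smul_mul_assoc]
    rw [smul_comm _ c, ← smul_sub]
    congr 1
    rw [← sub_eq_zero, ← h0]
    abel

theorem mem_span_mul_letters (l : List X) : ∀ f ∈ Submodule.span k (Set.range (leftNormed k par)),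
    mulLetters f l ∈ Submodule.span k (Set.range (leftNormed k par)) := by
  induction l with
  | nil => exact fun f hf => hf
  | cons a l ih =>
    intro f hf
    refine ih _ ?_
    change f * of k par a ∈ _
    induction hf using Submodule.span_induction with
    | mem x hx =>
      obtain ⟨w, rfl⟩ := hx
      refine Submodule.subset_span ⟨⟨w.head, w.tail ++ [a]⟩, ?_⟩
      simp [leftNormed, mulLetters]
    | zero => simp
    | add x y _ _ hx hy => rw [add_mul]; exact Submodule.add_mem _ hx hy
    | smul c x _ hx => rw [smul_mul_assoc]; exact Submodule.smul_mem _ _ hx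

/-- The term underlying a left-normed monomial. -/
theorem exists_term (x : X) (l : List X) :
    ∃ μ : FreeMagma X, mulLetters (of k par x) l = proj k par (term k μ) := by
  induction l using List.reverseRecOn with
  | nil => exact ⟨.of x, rfl⟩
  | append_singleton l a ih =>
    obtain ⟨μ, hμ⟩ := ih
    refine ⟨.mul μ (.of a), ?_⟩
    rw [mulLetters_append, hμ]
    change proj k par _ * proj k par _ = _
    rw [← proj_mul]
    simp only [term, MonoidAlgebra.single_mul_single, mul_one]
    rfl

theorem mul_mem_span (x : X) (l : List X) :
    ∀ f ∈ Submodule.span k (Set.range (leftNormed k par)),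
      f * mulLetters (of k par x) l ∈ Submodule.span k (Set.range (leftNormed k par)) := by
  induction l using List.reverseRecOn with
  | nil => exact mem_span_mul_letters [x]
  | append_singleton l a ih =>
    intro f hf
    obtain ⟨μ, hμ⟩ := exists_term (k := k) (par := par) x l
    have h1 := ih f hf
    have h2 := ih _ (mem_span_mul_letters [a] f hf)
    rw [mulLetters_append]
    change f * (_ * proj k par (term k (.of a))) ∈ _
    change (f * proj k par (term k (.of a))) * _ ∈ _ at h2
    rw [hμ] at h1 h2 ⊢
    rw [leibniz_term]
    exact Submodule.sub_mem _ (mem_span_mul_letters [a] _ h1) (Submodule.smul_mem _ _ h2)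

theorem span_leftNormed : Submodule.span k (Set.range (leftNormed k par)) = ⊤ := by
  have key : ∀ μ : FreeMagma X,
      proj k par (term k μ) ∈ Submodule.span k (Set.range (leftNormed k par)) := by
    intro μ
    induction μ with
    | ih1 x => exact Submodule.subset_span ⟨.of x, rfl⟩
    | ih2 μ ν hμ hν =>
      have h : term k (μ * ν) = term k μ * term k ν := by
        simp [term, MonoidAlgebra.single_mul_single]
      rw [h, proj_mul]
      generalize proj k par (term k ν) = g at hν
      induction hν using Submodule.span_induction with
      | mem y hy => obtain ⟨w, rfl⟩ := hy; exact mul_mem_span _ _ _ hμ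
      | zero => simp
      | add x y _ _ hx hy => rw [mul_add]; exact Submodule.add_mem _ hx hy
      | smul c x _ hx => rw [mul_smul_comm]; exact Submodule.smul_mem _ _ hx
  rw [eq_top_iff]
  rintro f -
  obtain ⟨f, rfl⟩ := proj_surjective f
  induction f using MonoidAlgebra.induction_linear with
  | zero => simp
  | add f g hf hg => rw [map_add]; exact Submodule.add_mem _ hf hg
  | single μ c =>
    have h : (MonoidAlgebra.single μ c : FreeNonUnitalNonAssocAlgebra k X) = c • term k μ := by
      simp [term]
    rw [h, map_smul]
    exact Submodule.smul_mem _ _ (key μ)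

/-- The iterated supercommutator of a term in the free associative algebra. -/
def bracketTerm (k : Type*) [Field k] (par : X → ZMod 2) :
    FreeMagma X → MonoidAlgebra k (FreeMonoid X)
  | .of x => MonoidAlgebra.single (FreeMonoid.of x) 1
  | .mul μ ν => bracketTerm k par μ * bracketTerm k par ν
      - sgn k (termParity par μ) (termParity par ν) •
        (bracketTerm k par ν * bracketTerm k par μ)

/-- The associative polynomial that a term represents. -/
def wordTerm (k : Type*) [Field k] (par : X → ZMod 2) :
    FreeMagma X → MonoidAlgebra k (FreeMonoid X)
  | .of x => MonoidAlgebra.single (FreeMonoid.of x) 1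
  | .mul μ ν => wordTerm k par μ * bracketTerm k par ν

/-- Linear extension of a function on terms. -/
def extend {M : Type*} [AddCommGroup M] [Module k M] (φ : FreeMagma X → M) :
    FreeNonUnitalNonAssocAlgebra k X →ₗ[k] M :=
  (Finsupp.linearCombination k φ) ∘ₗ (MonoidAlgebra.coeffLinearEquiv k).toLinearMap

theorem extend_single {M : Type*} [AddCommGroup M] [Module k M] (φ : FreeMagma X → M)
    (μ : FreeMagma X) (c : k) : extend φ (MonoidAlgebra.single μ c) = c • φ μ := by
  simp [extend]

/-- The part of parity `i` of the linear extension of `bracketTerm`. -/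
def bracketMap (k : Type*) [Field k] (par : X → ZMod 2) (i : ZMod 2) :
    FreeNonUnitalNonAssocAlgebra k X →ₗ[k] MonoidAlgebra k (FreeMonoid X) :=
  extend fun μ => if termParity par μ = i then bracketTerm k par μ else 0

/-- The linear extension of `wordTerm`. -/
def wordMap (k : Type*) [Field k] (par : X → ZMod 2) :
    FreeNonUnitalNonAssocAlgebra k X →ₗ[k] MonoidAlgebra k (FreeMonoid X) :=
  extend (wordTerm k par)

theorem wordMap_mul (f g : FreeNonUnitalNonAssocAlgebra k X) :
    wordMap k par (f * g) = wordMap k par f * (bracketMap k par 0 g + bracketMap k par 1 g) := by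
  induction f using MonoidAlgebra.induction_linear with
  | zero => simp
  | add f f' hf hf' => simp only [map_add, add_mul, hf, hf']
  | single μ c =>
    induction g using MonoidAlgebra.induction_linear with
    | zero => simp
    | add g g' hg hg' => rw [mul_add, map_add, hg, hg', map_add, map_add, ← mul_add]; congr 1; abel
    | single ν d =>
      rw [MonoidAlgebra.single_mul_single]
      simp only [wordMap, bracketMap, extend_single]
      change (c * d) • (wordTerm k par μ * bracketTerm k par ν) = _
      have : ∀ i : ZMod 2, i = 0 ∨ i = 1 := by decide
      rcases this (termParity par ν) with h | h <;> simp [h, mul_smul, smul_comm c d]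

theorem bracketMap_mul (i : ZMod 2) (f g : FreeNonUnitalNonAssocAlgebra k X) :
    bracketMap k par i (f * g) = ∑ j : ZMod 2,
      (bracketMap k par j f * bracketMap k par (i - j) g
        - sgn k j (i - j) • (bracketMap k par (i - j) g * bracketMap k par j f)) := by
  induction f using MonoidAlgebra.induction_linear with
  | zero => simp
  | add f f' hf hf' =>
    simp only [map_add, add_mul, mul_add, hf, hf', ← Finset.sum_add_distrib, smul_add]
    exact Finset.sum_congr rfl fun _ _ => by abel
  | single μ c =>
    induction g using MonoidAlgebra.induction_linear with
    | zero => simp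
    | add g g' hg hg' =>
      rw [mul_add, map_add, hg, hg', ← Finset.sum_add_distrib]
      simp only [map_add, add_mul, mul_add, smul_add]
      exact Finset.sum_congr rfl fun _ _ => by abel
    | single ν d =>
      rw [MonoidAlgebra.single_mul_single, Finset.sum_eq_single (termParity par μ)]
      · simp only [bracketMap, extend_single]
        have h : termParity par (μ * ν) = i ↔ termParity par ν = i - termParity par μ := by
          change termParity par μ + termParity par ν = i ↔ _
          rw [eq_sub_iff_add_eq, add_comm]
        by_cases hi : termParity par ν = i - termParity par μ
        · rw [if_pos (h.2 hi), if_pos trivial, if_pos hi, ← hi]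
          change (c * d) • (bracketTerm k par μ * bracketTerm k par ν
            - sgn k (termParity par μ) (termParity par ν) •
              (bracketTerm k par ν * bracketTerm k par μ)) = _
          simp only [smul_mul_assoc, mul_smul_comm, smul_sub, mul_smul, smul_comm c d]
          simp only [smul_comm (sgn k (termParity par μ) (termParity par ν))]
        · rw [if_neg (mt h.1 hi), if_neg hi]; simp
      · intro j _ hj
        simp [bracketMap, extend_single, hj.symm]
      · simp

theorem bracketTerm_leibniz (μ ν τ : FreeMagma X) :
    bracketTerm k par (μ * (ν * τ)) = bracketTerm k par ((μ * ν) * τ)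
      - sgn k (termParity par ν) (termParity par τ) • bracketTerm k par ((μ * τ) * ν) := by
  have hm : ∀ α β : FreeMagma X, bracketTerm k par (α * β) =
      bracketTerm k par α * bracketTerm k par β
      - sgn k (termParity par α) (termParity par β) •
        (bracketTerm k par β * bracketTerm k par α) := fun _ _ => rfl
  have hp : ∀ α β : FreeMagma X, termParity par (α * β) =
    termParity par α + termParity par β := fun _ _ => rfl
  simp only [hm, hp]
  generalize termParity par μ = a
  generalize termParity par ν = b
  generalize termParity par τ = c
  have : ∀ i : ZMod 2, i = 0 ∨ i = 1 := by decide
  have h2 : (1 : ZMod 2) + 1 = 0 := by decide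
  have h1 : (1 : ZMod 2).val = 1 := by decide
  rcases this a with rfl | rfl <;> rcases this b with rfl | rfl <;>
    rcases this c with rfl | rfl <;> simp [sgn, h2, h1] <;> noncomm_ring

theorem wordTerm_leibniz (μ ν τ : FreeMagma X) :
    wordTerm k par (μ * (ν * τ)) = wordTerm k par ((μ * ν) * τ)
      - sgn k (termParity par ν) (termParity par τ) • wordTerm k par ((μ * τ) * ν) := by
  change wordTerm k par μ * (bracketTerm k par ν * bracketTerm k par τ
      - sgn k (termParity par ν) (termParity par τ) •
        (bracketTerm k par τ * bracketTerm k par ν)) =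
    wordTerm k par μ * bracketTerm k par ν * bracketTerm k par τ
      - sgn k (termParity par ν) (termParity par τ) •
        (wordTerm k par μ * bracketTerm k par τ * bracketTerm k par ν)
  rw [mul_sub, mul_smul_comm, mul_assoc, mul_assoc]

theorem idealSpan_le_ker :
    idealSpan k (leibnizRelations k par) ≤ LinearMap.ker (wordMap k par) := by
  have h : idealSpan k (leibnizRelations k par) ≤
      LinearMap.ker (wordMap k par) ⊓ ⨅ i, LinearMap.ker (bracketMap k par i) := by
    refine idealSpan_le ?_ ?_
    · intro x y hy
      simp only [Submodule.mem_inf, Submodule.mem_iInf, LinearMap.mem_ker] at hy ⊢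
      simp [wordMap_mul, bracketMap_mul, hy.1, hy.2]
    · rintro _ ⟨μ, ν, τ, rfl⟩
      have ht : ∀ α β : FreeMagma X, term k α * term k β = term k (α * β) := fun α β => by
        simp [term, MonoidAlgebra.single_mul_single]
      simp only [ht, SetLike.mem_coe, Submodule.mem_inf, Submodule.mem_iInf, LinearMap.mem_ker,
        map_add, map_sub, map_smul]
      refine ⟨?_, fun i => ?_⟩
      · simp only [term, wordMap, extend_single, one_smul, wordTerm_leibniz μ ν τ]
        abel
      · have hp : ∀ α β : FreeMagma X, termParity par (α * β) =
          termParity par α + termParity par β := fun _ _ => rfl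
        have e1 : termParity par (μ * ν * τ) = termParity par (μ * (ν * τ)) := by
          simp only [hp]; ring
        have e2 : termParity par (μ * τ * ν) = termParity par (μ * (ν * τ)) := by
          simp only [hp]; ring
        simp only [term, bracketMap, extend_single, one_smul, e1, e2]
        split_ifs
        · rw [bracketTerm_leibniz μ ν τ]; abel
        · simp
  exact h.trans inf_le_left

variable (k par) in
/-- The linear map that sends `[a₁ ⋯ aₙ]_L` to the associative word `a₁ ⋯ aₙ`. -/
def toWords : Lbs k par →ₗ[k] MonoidAlgebra k (FreeMonoid X) :=
  (idealSpan k (leibnizRelations k par)).liftQ (wordMap k par) idealSpan_le_ker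

theorem toWords_mulLetters (x : X) (l : List X) :
    toWords k par (mulLetters (of k par x) l) =
      MonoidAlgebra.single (FreeMonoid.ofList (x :: l)) 1 := by
  induction l using List.reverseRecOn with
  | nil =>
    change wordMap k par (term k (.of x)) = _
    simp only [wordMap, term, extend_single, one_smul]
    rfl
  | append_singleton l a ih =>
    rw [mulLetters_append]
    change toWords k par (mulLetters (of k par x) l * proj k par (term k (.of a))) = _
    obtain ⟨f, hf⟩ := proj_surjective (mulLetters (of k par x) l)
    rw [← hf] at ih ⊢
    change wordMap k par f = _ at ih
    rw [← proj_mul]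
    change wordMap k par (f * term k (.of a)) = _
    rw [wordMap_mul, ih]
    have : bracketMap k par 0 (term k (.of a)) + bracketMap k par 1 (term k (.of a)) =
        MonoidAlgebra.single (FreeMonoid.of a) 1 := by
      simp only [bracketMap, term, extend_single, one_smul]
      change (if par a = 0 then MonoidAlgebra.single (FreeMonoid.of a) (1 : k) else 0)
        + (if par a = 1 then MonoidAlgebra.single (FreeMonoid.of a) (1 : k) else 0) = _
      have : ∀ i : ZMod 2, i = 0 ∨ i = 1 := by decide
      rcases this (par a) with h | h <;> simp [h]
    rw [this, MonoidAlgebra.single_mul_single, one_mul]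
    rfl

theorem linearIndependent_leftNormed : LinearIndependent k (leftNormed k par) := by
  refine LinearIndependent.of_comp
    ((MonoidAlgebra.coeffLinearEquiv k).toLinearMap ∘ₗ toWords k par) ?_
  have h : ((MonoidAlgebra.coeffLinearEquiv k).toLinearMap ∘ₗ toWords k par) ∘ leftNormed k par =
      (fun w : FreeMonoid X => (Finsupp.single w (1 : k))) ∘
        fun w : FreeSemigroup X => FreeMonoid.ofList (w.head :: w.tail) := by
    funext w
    simp only [Function.comp_apply, LinearMap.comp_apply, leftNormed, toWords_mulLetters]
    simp
  rw [h]
  refine LinearIndependent.comp (Finsupp.linearIndependent_single_one k (FreeMonoid X)) _ ?_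
  intro v w hvw
  have := FreeMonoid.ofList.injective hvw
  rw [List.cons.injEq] at this
  exact FreeSemigroup.ext this.1 this.2

variable (k par) in
/-- The linear basis `NF(X)` of `Lbs(X)`: the left-normed monomials `[a₁ ⋯ aₙ]_L`, `n ≥ 1`,
indexed by the nonempty words `a₁ ⋯ aₙ`. -/
def nfBasis : Module.Basis (FreeSemigroup X) k (Lbs k par) :=
  Module.Basis.mk linearIndependent_leftNormed span_leftNormed.ge

theorem nfBasis_apply (w : FreeSemigroup X) : nfBasis k par w = leftNormed k par w :=
  Module.Basis.mk_apply _ _ _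

end Lbs

/-! ### Monomials and the deg-length-lex order

The elements of `NF(X)` are identified with nonempty words, that is, with the elements of
`FreeSemigroup X`. -/

/-- The degree of a word, for a given degree function on the letters. -/
def wordDeg (deg : X → ℕ+) (w : FreeSemigroup X) : ℕ :=
  ((w.head :: w.tail).map fun a => (deg a : ℕ)).sum

/-- The parity of a word: the sum modulo 2 of the parities of its letters. -/
def wordParity (par : X → ZMod 2) (w : FreeSemigroup X) : ZMod 2 :=
  ((w.head :: w.tail).map par).sum

/-- The weight `(deg(w), ℓ(w), a₁, …, aₙ)` of the word `w = a₁ ⋯ aₙ`, in a type that carries the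
lexicographic order. -/
def wt [LinearOrder X] (deg : X → ℕ+) (w : FreeSemigroup X) : ℕ ×ₗ (ℕ ×ₗ List X) :=
  toLex (wordDeg deg w, toLex (w.length, w.head :: w.tail))

theorem wt_injective [LinearOrder X] (deg : X → ℕ+) : Function.Injective (wt deg) := by
  intro v w h
  have h1 := congrArg (fun p => (ofLex (ofLex p).2).2) h
  simp only [wt, ofLex_toLex, List.cons.injEq] at h1
  exact FreeSemigroup.ext h1.1 h1.2

/-- The deg-length-lex order on `NF(X)`: words are compared by their weights,
lexicographically. -/
@[reducible]
def degLenLex [LinearOrder X] (deg : X → ℕ+) : LinearOrder (FreeSemigroup X) :=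
  LinearOrder.lift' (wt deg) (wt_injective deg)

namespace Lbs

variable {k : Type*} [Field k] {par : X → ZMod 2}

/-- The coefficient of the monomial `[w]_L` in `f`. -/
def coeff (f : Lbs k par) (w : FreeSemigroup X) : k := (nfBasis k par).repr f w

/-- The set of monomials that occur in `f` with a nonzero coefficient. -/
def supp (f : Lbs k par) : Finset (FreeSemigroup X) := ((nfBasis k par).repr f).support

/-- `f` is homogeneous if all its monomials are of parity 0 or all of them are of parity 1. -/
def IsHomogeneous (f : Lbs k par) : Prop :=
  ∃ i : ZMod 2, ∀ w ∈ supp f, wordParity par w = i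

variable [LinearOrder X] (deg : X → ℕ+)

/-- The leading monomial of `f`: the greatest monomial of `f` in the deg-length-lex order.
The leading monomial of `0` is `⊥`, which is smaller than all monomials. -/
def lead (f : Lbs k par) : WithBot (FreeSemigroup X) :=
  letI := degLenLex deg
  (supp f).max

/-- The degree of the leading monomial of `f`, with the convention that it is `0` for `f = 0`. -/
def leadDeg (f : Lbs k par) : ℕ := (lead deg f).recBotCoe 0 (wordDeg deg)

/-- The length of the leading monomial of `f`, with the convention that it is `0` for `f = 0`. -/
def leadLength (f : Lbs k par) : ℕ := (lead deg f).recBotCoe 0 FreeSemigroup.length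

/-- `f` is monic if it is nonzero and the coefficient of its leading monomial is `1`. -/
def IsMonic (f : Lbs k par) : Prop :=
  ∃ w : FreeSemigroup X, lead deg f = w ∧ coeff f w = 1

/-- `lead f < lead g` in the deg-length-lex order. -/
def LeadLT (f g : Lbs k par) : Prop :=
  letI := degLenLex deg
  lead deg f < lead deg g

/-- `IsNormal deg s h`: the element `h` is a normal `s`-polynomial, that is,
`h = [s a₁ ⋯ aₘ]_L` with `m ≥ 0`, or `h = [a₁ ⋯ aₜ s aₜ₊₁ ⋯ aₘ]_L` with `1 ≤ t ≤ m` if the leading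
monomial of `s` has length 1. -/
inductive IsNormal (s : Lbs k par) : Lbs k par → Prop
  | right (l : List X) : IsNormal s (mulLetters s l)
  | middle (hs : leadLength deg s = 1) (u : FreeSemigroup X) (l : List X) :
      IsNormal s (mulLetters (leftNormed k par u * s) l)

/-- `h` is a normal `S`-polynomial. -/
def IsNormalPoly (S : Set (Lbs k par)) (h : Lbs k par) : Prop :=
  ∃ s ∈ S, IsNormal deg s h

/-- `h` is trivial modulo `(S, lead f)`: it is a linear combination of normal `S`-polynomials whose
leading monomials are smaller than the leading monomial of `f`. -/
def TrivialBelow (S : Set (Lbs k par)) (f h : Lbs k par) : Prop :=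
  h ∈ Submodule.span k {p | IsNormalPoly deg S p ∧ LeadLT deg p f}

/-- `h` is trivial modulo `(S, n)`: it is a linear combination of normal `S`-polynomials whose
leading monomials are of degree at most `n`. -/
def TrivialDeg (S : Set (Lbs k par)) (n : ℕ) (h : Lbs k par) : Prop :=
  h ∈ Submodule.span k {p | IsNormalPoly deg S p ∧ leadDeg deg p ≤ n}

/-- `S` is a Gröbner–Shirshov basis: every left multiplication composition `([μ]_L f)`, where
`f ∈ S`, `ℓ(lead f) > 1` and `([μ]_L f) ≠ 0`, is trivial modulo `(S, deg μ + deg (lead f))`, and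
every inclusion composition `f - h`, where `f ≠ g` are in `S` and `h` is a normal `g`-polynomial
with `lead f = lead h`, is trivial modulo `(S, lead f)`. -/
def IsGroebnerShirshov (S : Set (Lbs k par)) : Prop :=
  (∀ f ∈ S, ∀ μ : FreeSemigroup X, 1 < leadLength deg f → leftNormed k par μ * f ≠ 0 →
    TrivialDeg deg S (wordDeg deg μ + leadDeg deg f) (leftNormed k par μ * f)) ∧
  (∀ f ∈ S, ∀ g ∈ S, f ≠ g → ∀ h, IsNormal deg g h → lead deg f = lead deg h →
    TrivialBelow deg S f (f - h))

/-- `Irr(S)`: the monomials that are not the leading monomial of any normal `S`-polynomial. -/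
def Irr (S : Set (Lbs k par)) : Set (FreeSemigroup X) :=
  {w | ∀ h, IsNormalPoly deg S h → lead deg h ≠ w}

end Lbs

end Free

end

end LeibnizSuper

/-! Multiplying on the right by a letter appends that letter to a left-normed word and strictly
preserves the deg-length-lex order. Left multiplication does not: `u * w` has to be expanded by the
Leibniz superidentity, which permutes letters and can cancel everything (`x * (y * y) = 0` for even
`y`), so only the degree is controlled. The exception is a leading monomial that is a single letter
`a`: a word below `a` has smaller degree or is a smaller letter of the same degree, so `u * f` has
leading monomial `u a`. Hence normal polynomials over a monic `S` are monic with predictable leading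
monomials.

(i) ⇒ (ii). Triviality of left multiplications extends from `S` to all normal polynomials
(`LeftTrivial.mul_normal`), so the normal polynomials span `Id(S)` (`LeftTrivial.idealSpan_le`). If
two of them share a leading monomial, their difference is a combination of smaller ones: either one
insertion lies inside the other's leading monomial and an inclusion composition applies, or the
insertions are disjoint and the difference can be rewritten directly (`IsGroebnerShirshov.sub_mem`).
Well-founded induction on a bound for the leading monomials in a combination then gives (ii)
(`IsGroebnerShirshov.exists_normal_of_mem_normalSpan`).

(ii) ⇒ (i). Repeated cancellation of leading terms writes each element of `Id(S)` through normal
polynomials whose leading monomials do not exceed its own (`mem_normalSpan_of_lead_eq`), and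
compositions lie in `Id(S)`.

(ii) ⇔ (iii). Irreducible words span the quotient for every monic `S`. Their independence says that
their span meets `Id(S)` only in `0`, which is (ii) in another form (`exists_normal_iff_disjoint`).
-/

namespace LeibnizSuper

/-! ### Words -/

section Words

variable {X : Type*}

/-- The letters of a nonempty word. -/
def letters (w : FreeSemigroup X) : List X := w.head :: w.tail

theorem letters_injective : Function.Injective (letters (X := X)) := by
  intro v w h
  simp only [letters, List.cons.injEq] at h
  exact FreeSemigroup.ext h.1 h.2

/-- The word `w` followed by the letters of `l`. -/
def appendWord (w : FreeSemigroup X) (l : List X) : FreeSemigroup X := ⟨w.head, w.tail ++ l⟩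

@[simp]
theorem letters_appendWord (w : FreeSemigroup X) (l : List X) :
    letters (appendWord w l) = letters w ++ l := rfl

@[simp]
theorem letters_of (a : X) : letters (FreeSemigroup.of a) = [a] := rfl

@[simp]
theorem appendWord_nil (w : FreeSemigroup X) : appendWord w [] = w :=
  letters_injective (by simp)

@[simp]
theorem appendWord_appendWord (w : FreeSemigroup X) (l l' : List X) :
    appendWord (appendWord w l) l' = appendWord w (l ++ l') :=
  letters_injective (by simp)

theorem appendWord_ne_of (u : FreeSemigroup X) (a b : X) (l : List X) :
    appendWord u (a :: l) ≠ .of b := by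
  intro h
  simpa [appendWord, FreeSemigroup.of] using congrArg FreeSemigroup.tail h

theorem length_eq_length_letters (w : FreeSemigroup X) : w.length = (letters w).length := rfl

/-- The sum of the values of a function over the letters of a word. -/
def wordSum {M : Type*} [AddCommMonoid M] (φ : X → M) (w : FreeSemigroup X) : M :=
  ((letters w).map φ).sum

theorem wordSum_of {M : Type*} [AddCommMonoid M] (φ : X → M) (a : X) :
    wordSum φ (.of a) = φ a := by
  simp [wordSum]

theorem wordSum_appendWord {M : Type*} [AddCommMonoid M] (φ : X → M) (w : FreeSemigroup X)
    (l : List X) : wordSum φ (appendWord w l) = wordSum φ w + (l.map φ).sum := by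
  simp [wordSum]

theorem wordDeg_appendWord (deg : X → ℕ+) (w : FreeSemigroup X) (l : List X) :
    wordDeg deg (appendWord w l) = wordDeg deg w + (l.map fun a => (deg a : ℕ)).sum :=
  wordSum_appendWord _ _ _

theorem wordDeg_of (deg : X → ℕ+) (a : X) : wordDeg deg (.of a) = deg a := wordSum_of _ a

/-- Equal lengths exclude the case of a proper prefix, the only one in which appending could reverse
the comparison. -/
theorem lex_append_right_of_length_eq {r : X → X → Prop} {s t : List X} (h : List.Lex r s t)
    (hl : s.length = t.length) (l : List X) : List.Lex r (s ++ l) (t ++ l) := by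
  induction h with
  | nil => simp at hl
  | cons _ ih => exact .cons (ih (by simpa using hl))
  | rel h => exact .rel h

/-! ### The deg-length-lex order on words. -/

variable [LinearOrder X] (deg : X → ℕ+)

theorem wt_lt_iff (v w : FreeSemigroup X) : wt deg v < wt deg w ↔
    wordDeg deg v < wordDeg deg w ∨ (wordDeg deg v = wordDeg deg w ∧
      List.Shortlex (· < ·) (letters v) (letters w)) := by
  simp only [wt, Prod.Lex.lt_iff, ofLex_toLex, List.shortlex_def]
  rfl

/-- The lexicographic order on lists alone is not well-founded in general; grouping the length with
the letters gives the shortlex order, which is. -/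
theorem wellFounded_wt [WellFoundedLT X] :
    WellFounded fun v w : FreeSemigroup X => wt deg v < wt deg w := by
  have h := InvImage.wf (fun w : FreeSemigroup X => (wordDeg deg w, letters w))
    (WellFounded.prod_lex (wellFounded_lt (α := ℕ))
      (List.Shortlex.wf (wellFounded_lt (α := X))))
  refine Subrelation.wf (fun {v w} hvw => ?_) h
  simpa [InvImage, Prod.lex_def] using (wt_lt_iff deg v w).1 hvw

variable {deg}

theorem wordDeg_le_of_wt_lt {v w : FreeSemigroup X} (h : wt deg v < wt deg w) :
    wordDeg deg v ≤ wordDeg deg w := by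
  rcases (wt_lt_iff deg v w).1 h with h | h
  exacts [h.le, h.1.le]

theorem wordDeg_le_of_wt_le {v w : FreeSemigroup X} (h : wt deg v ≤ wt deg w) :
    wordDeg deg v ≤ wordDeg deg w := by
  rcases h.eq_or_lt with h | h
  exacts [(congrArg _ (wt_injective deg h)).le, wordDeg_le_of_wt_lt h]

theorem wt_lt_of_wordDeg_lt {v w : FreeSemigroup X} (h : wordDeg deg v < wordDeg deg w) :
    wt deg v < wt deg w :=
  (wt_lt_iff deg v w).2 (.inl h)

theorem wt_appendWord_lt {v w : FreeSemigroup X} (h : wt deg v < wt deg w) (l : List X) :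
    wt deg (appendWord v l) < wt deg (appendWord w l) := by
  rw [wt_lt_iff, List.shortlex_def] at h ⊢
  simp only [wordDeg_appendWord, letters_appendWord, List.length_append]
  rcases h with h | ⟨h, h' | ⟨h', h''⟩⟩
  · exact .inl (by omega)
  · exact .inr ⟨by omega, .inl (by omega)⟩
  · exact .inr ⟨by omega, .inr ⟨by omega, lex_append_right_of_length_eq h'' h' l⟩⟩

/-- A word that is smaller than a letter of the same degree is a smaller letter. -/
theorem wt_lt_of_iff {v : FreeSemigroup X} {a : X} : wt deg v < wt deg (.of a) ↔
    wordDeg deg v < deg a ∨ ∃ b, v = .of b ∧ b < a ∧ deg b = deg a := by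
  rw [wt_lt_iff, wordDeg_of, letters_of]
  refine or_congr_right ⟨?_, ?_⟩
  · rintro ⟨h, h'⟩
    rw [List.shortlex_def] at h'
    obtain ⟨b, t⟩ := v
    rcases h' with h' | ⟨h', h''⟩
    · simp [letters] at h'
    · obtain rfl : t = [] := by simpa [letters] using h'
      refine ⟨b, rfl, ?_, ?_⟩
      · simpa [letters] using h''
      · exact PNat.coe_injective ((wordDeg_of deg b).symm.trans h)
  · rintro ⟨b, rfl, h, h'⟩
    refine ⟨by rw [wordDeg_of, h'], ?_⟩
    simpa [List.shortlex_singleton_iff] using h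

theorem wt_appendWord_letter_lt (u : FreeSemigroup X) {a b : X} (h : b < a)
    (hd : deg b = deg a) : wt deg (appendWord u [b]) < wt deg (appendWord u [a]) := by
  rw [wt_lt_iff]
  refine .inr ⟨by simp [wordDeg_appendWord, hd], ?_⟩
  simp only [letters_appendWord]
  exact List.Shortlex.append_left (by simpa [List.shortlex_singleton_iff] using h) _

end Words

/-! ### Gradings of the free Leibniz superalgebra -/

namespace Lbs

variable {k X : Type*} [Field k] {par : X → ZMod 2}

@[simp]
theorem mulLetters_nil (f : Lbs k par) : mulLetters f [] = f := rfl

@[simp]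
theorem mulLetters_cons (f : Lbs k par) (a : X) (l : List X) :
    mulLetters f (a :: l) = mulLetters (f * of k par a) l := rfl

variable (k par) in
/-- Right multiplication by a sequence of letters, as a linear map. -/
noncomputable def mulLettersMap (l : List X) : Lbs k par →ₗ[k] Lbs k par :=
  l.foldl (fun φ a => (LinearMap.mulRight k (of k par a)) ∘ₗ φ) LinearMap.id

theorem mulLettersMap_apply (l : List X) (f : Lbs k par) :
    mulLettersMap k par l f = mulLetters f l := by
  induction l using List.reverseRecOn with
  | nil => rfl
  | append_singleton l a ih =>
    rw [mulLetters_append, ← ih]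
    simp [mulLettersMap]

theorem mulLetters_sub (f g : Lbs k par) (l : List X) :
    mulLetters (f - g) l = mulLetters f l - mulLetters g l := by
  simp only [← mulLettersMap_apply, map_sub]

theorem mulLetters_leftNormed (w : FreeSemigroup X) (l : List X) :
    mulLetters (leftNormed k par w) l = leftNormed k par (appendWord w l) := by
  rw [leftNormed, ← mulLetters_append]
  rfl

theorem leftNormed_of (a : X) : leftNormed k par (.of a) = of k par a := rfl

theorem leftNormed_mul_of (w : FreeSemigroup X) (a : X) :
    leftNormed k par w * of k par a = leftNormed k par (appendWord w [a]) :=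
  mulLetters_leftNormed w [a]

/-- Induction on words, one letter at a time on the right. -/
theorem word_induction {P : FreeSemigroup X → Prop} (of : ∀ a, P (.of a))
    (append : ∀ w a, P w → P (appendWord w [a])) (w : FreeSemigroup X) : P w := by
  obtain ⟨x, l⟩ := w
  induction l using List.reverseRecOn with
  | nil => exact of x
  | append_singleton l a ih => exact append ⟨x, l⟩ a ih

/-- The defining relations concern bracketed terms and their parities; this carries them over to
left-normed words. -/
theorem exists_term_parity (w : FreeSemigroup X) : ∃ μ : FreeMagma X,
    leftNormed k par w = proj k par (term k μ) ∧ termParity par μ = wordSum par w := by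
  induction w using word_induction with
  | of a => exact ⟨.of a, rfl, (wordSum_of par a).symm⟩
  | append w a ih =>
    obtain ⟨μ, h, hp⟩ := ih
    refine ⟨.mul μ (.of a), ?_, ?_⟩
    · rw [← leftNormed_mul_of, h]
      change proj k par _ * proj k par _ = _
      rw [← proj_mul]
      simp only [term, MonoidAlgebra.single_mul_single, mul_one]
      rfl
    · rw [wordSum_appendWord, ← hp]
      simp [termParity]

theorem leibniz_leftNormed (f : Lbs k par) (v w : FreeSemigroup X) :
    f * (leftNormed k par v * leftNormed k par w) =
      (f * leftNormed k par v) * leftNormed k par w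
      - sgn k (wordSum par v) (wordSum par w) •
        ((f * leftNormed k par w) * leftNormed k par v) := by
  obtain ⟨μ, h, hp⟩ := exists_term_parity (k := k) (par := par) v
  obtain ⟨ν, h', hp'⟩ := exists_term_parity (k := k) (par := par) w
  rw [h, h', ← hp, ← hp', leibniz_term]

/-- The span of the monomials in a set of words. -/
noncomputable def wordSpan (k : Type*) [Field k] (par : X → ZMod 2) (s : Set (FreeSemigroup X)) :
    Submodule k (Lbs k par) :=
  Submodule.span k (leftNormed k par '' s)

theorem leftNormed_mem_wordSpan {s : Set (FreeSemigroup X)} {w : FreeSemigroup X} (h : w ∈ s) :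
    leftNormed k par w ∈ wordSpan k par s :=
  Submodule.subset_span ⟨w, h, rfl⟩

theorem wordSpan_le {s : Set (FreeSemigroup X)} {N : Submodule k (Lbs k par)}
    (h : ∀ w ∈ s, leftNormed k par w ∈ N) : wordSpan k par s ≤ N :=
  Submodule.span_le.2 (by rintro _ ⟨w, hw, rfl⟩; exact h w hw)

theorem wordSpan_mono {s t : Set (FreeSemigroup X)} (h : s ⊆ t) :
    wordSpan k par s ≤ wordSpan k par t :=
  Submodule.span_mono (Set.image_mono h)

theorem wordSpan_sup_mono {t t' : Set (FreeSemigroup X)} {N : Submodule k (Lbs k par)}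
    {f : Lbs k par} (h : t ⊆ t') (hf : f ∈ wordSpan k par t ⊔ N) : f ∈ wordSpan k par t' ⊔ N :=
  sup_le_sup_right (wordSpan_mono h) N hf

theorem wordSpan_univ : wordSpan k par (Set.univ : Set (FreeSemigroup X)) = ⊤ := by
  rw [wordSpan, Set.image_univ, span_leftNormed]

theorem mem_wordSpan_iff {s : Set (FreeSemigroup X)} {f : Lbs k par} :
    f ∈ wordSpan k par s ↔ ∀ w ∈ supp f, w ∈ s := by
  have h : (leftNormed k par : FreeSemigroup X → Lbs k par) = nfBasis k par :=
    funext fun w => (nfBasis_apply w).symm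
  rw [wordSpan, h, Module.Basis.mem_span_image]
  rfl

theorem mulLetters_mem {s : Set (FreeSemigroup X)} {N : Submodule k (Lbs k par)} (l : List X)
    (h : ∀ w ∈ s, leftNormed k par (appendWord w l) ∈ N) {f : Lbs k par}
    (hf : f ∈ wordSpan k par s) : mulLetters f l ∈ N := by
  rw [← mulLettersMap_apply, ← Submodule.mem_comap]
  refine wordSpan_le (N := N.comap (mulLettersMap k par l)) (fun w hw => ?_) hf
  rw [Submodule.mem_comap, mulLettersMap_apply, mulLetters_leftNormed]
  exact h w hw

/-- A product lies in a subspace if the products of the words in the factors do. -/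
theorem mul_mem_of_wordSpan {s t : Set (FreeSemigroup X)} {N : Submodule k (Lbs k par)}
    (h : ∀ v ∈ s, ∀ w ∈ t, leftNormed k par v * leftNormed k par w ∈ N) {f g : Lbs k par}
    (hf : f ∈ wordSpan k par s) (hg : g ∈ wordSpan k par t) : f * g ∈ N := by
  refine wordSpan_le (N := N.comap (LinearMap.mulRight k g)) (fun v hv => ?_) hf
  exact wordSpan_le (N := N.comap (LinearMap.mulLeft k (leftNormed k par v)))
    (fun w hw => h v hv w hw) hg

theorem mul_mem_of_wordSpan_right {t : Set (FreeSemigroup X)} {N : Submodule k (Lbs k par)}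
    {f : Lbs k par} (h : ∀ w ∈ t, f * leftNormed k par w ∈ N) {g : Lbs k par}
    (hg : g ∈ wordSpan k par t) : f * g ∈ N :=
  wordSpan_le (N := N.comap (LinearMap.mulLeft k f)) h hg

/-- The component of `Lbs(X)` of weight `m`, for a weight function on the letters. -/
noncomputable def graded (k : Type*) [Field k] (par : X → ZMod 2) {M : Type*} [AddCommMonoid M]
    (φ : X → M) (m : M) : Submodule k (Lbs k par) :=
  wordSpan k par {w | wordSum φ w = m}

section Graded

variable {M : Type*} [AddCommMonoid M] {φ : X → M}

theorem leftNormed_mem_graded (w : FreeSemigroup X) :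
    leftNormed k par w ∈ graded k par φ (wordSum φ w) :=
  leftNormed_mem_wordSpan rfl

theorem mulLetters_mem_graded {m : M} {f : Lbs k par} (hf : f ∈ graded k par φ m) (l : List X) :
    mulLetters f l ∈ graded k par φ (m + (l.map φ).sum) := by
  refine mulLetters_mem l (fun w hw => leftNormed_mem_wordSpan ?_) hf
  obtain rfl : wordSum φ w = m := hw
  exact wordSum_appendWord φ w l

/-- Induction on the right factor through `f(wa) = (fw)a ∓ (fa)w`. The last term calls for the
hypothesis at `f * a`, so `f` stays general. The letters get permuted, which is harmless for weights
in a commutative monoid; parity and degree are the two instances needed. -/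
theorem mul_leftNormed_mem_graded (w : FreeSemigroup X) :
    ∀ {m : M} {f : Lbs k par}, f ∈ graded k par φ m →
      f * leftNormed k par w ∈ graded k par φ (m + wordSum φ w) := by
  induction w using word_induction with
  | of a =>
    intro m f hf
    simpa [wordSum_of, leftNormed_of] using mulLetters_mem_graded hf [a]
  | append w a ih =>
    intro m f hf
    rw [← leftNormed_mul_of, ← leftNormed_of, leibniz_leftNormed, wordSum_appendWord]
    refine Submodule.sub_mem _ ?_ (Submodule.smul_mem _ _ ?_)
    · simpa [add_assoc, leftNormed_of] using mulLetters_mem_graded (ih hf) [a]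
    · have h := ih (mulLetters_mem_graded hf [a])
      rwa [add_assoc, add_comm _ (wordSum φ w)] at h

theorem mul_mem_graded {m n : M} {f g : Lbs k par} (hf : f ∈ graded k par φ m)
    (hg : g ∈ graded k par φ n) : f * g ∈ graded k par φ (m + n) :=
  mul_mem_of_wordSpan_right (by rintro w rfl; exact mul_leftNormed_mem_graded w hf) hg

end Graded

/-- The Leibniz superidentity for elements that are homogeneous with respect to the parity. -/
theorem leibniz_graded {i j : ZMod 2} (f : Lbs k par) {g h : Lbs k par}
    (hg : g ∈ graded k par par i) (hh : h ∈ graded k par par j) :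
    f * (g * h) = (f * g) * h - sgn k i j • ((f * h) * g) := by
  induction hg using Submodule.span_induction with
  | zero => simp
  | add g g' _ _ e e' => simp only [add_mul, mul_add, smul_add, e, e']; abel
  | smul c g _ e =>
    simp only [smul_mul_assoc, mul_smul_comm, e, smul_sub]
    rw [smul_comm]
  | mem _ hg =>
    obtain ⟨v, rfl, rfl⟩ := hg
    induction hh using Submodule.span_induction with
    | zero => simp
    | add g g' _ _ e e' => simp only [add_mul, mul_add, smul_add, e, e']; abel
    | smul c g _ e =>
      simp only [smul_mul_assoc, mul_smul_comm, e, smul_sub]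
      rw [smul_comm]
    | mem _ hh =>
      obtain ⟨w, rfl, rfl⟩ := hh
      exact leibniz_leftNormed f v w

theorem IsHomogeneous.exists_mem_graded {f : Lbs k par} (hf : f.IsHomogeneous) :
    ∃ i, f ∈ graded k par par i := by
  obtain ⟨i, hi⟩ := hf
  exact ⟨i, mem_wordSpan_iff.2 hi⟩

variable {deg : X → ℕ+}

/-! ### Coefficients and degrees -/

theorem coeff_leftNormed (v w : FreeSemigroup X) :
    coeff (leftNormed k par v) w = Finsupp.single v 1 w := by
  rw [coeff, ← nfBasis_apply, Module.Basis.repr_self]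

theorem coeff_leftNormed_self (w : FreeSemigroup X) : coeff (leftNormed k par w) w = 1 := by
  rw [coeff_leftNormed, Finsupp.single_eq_same]

theorem coeff_leftNormed_of_ne {v w : FreeSemigroup X} (h : v ≠ w) :
    coeff (leftNormed k par v) w = 0 := by
  rw [coeff_leftNormed, Finsupp.single_eq_of_ne' h]

theorem coeff_add (f g : Lbs k par) (w : FreeSemigroup X) :
    coeff (f + g) w = coeff f w + coeff g w := by
  simp [coeff]

theorem coeff_sub (f g : Lbs k par) (w : FreeSemigroup X) :
    coeff (f - g) w = coeff f w - coeff g w := by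
  simp [coeff]

theorem coeff_smul (c : k) (f : Lbs k par) (w : FreeSemigroup X) :
    coeff (c • f) w = c * coeff f w := by
  simp [coeff]

theorem mem_supp {f : Lbs k par} {w : FreeSemigroup X} : w ∈ supp f ↔ coeff f w ≠ 0 :=
  Finsupp.mem_support_iff

/-- The span of the monomials of degree at most `n`. -/
noncomputable def degLE (k : Type*) [Field k] (par : X → ZMod 2) (deg : X → ℕ+) (n : ℕ) :
    Submodule k (Lbs k par) :=
  wordSpan k par {v | wordDeg deg v ≤ n}

theorem mul_mem_degLE {m n : ℕ} {f g : Lbs k par} (hf : f ∈ degLE k par deg m)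
    (hg : g ∈ degLE k par deg n) : f * g ∈ degLE k par deg (m + n) := by
  refine mul_mem_of_wordSpan (fun v hv w hw => ?_) hf hg
  have h : leftNormed k par v * leftNormed k par w ∈
      graded k par (fun a => (deg a : ℕ)) (wordDeg deg v + wordDeg deg w) :=
    mul_mem_graded (leftNormed_mem_graded v) (leftNormed_mem_graded w)
  refine wordSpan_mono (fun u hu => ?_) h
  change wordDeg deg u = _ at hu
  change wordDeg deg u ≤ _
  rw [hu]
  exact add_le_add hv hw

theorem leftNormed_mem_degLE (w : FreeSemigroup X) :
    leftNormed k par w ∈ degLE k par deg (wordDeg deg w) :=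
  leftNormed_mem_wordSpan (le_refl (wordDeg deg w))

variable [LinearOrder X]

/-! ### Leading monomials -/

/-- The span of the monomials smaller than `w`. -/
noncomputable def below (k : Type*) [Field k] (par : X → ZMod 2) (deg : X → ℕ+)
    (w : FreeSemigroup X) : Submodule k (Lbs k par) :=
  wordSpan k par {v | wt deg v < wt deg w}

variable (deg) in
/-- `f` is monic with leading monomial `w`. -/
def HasLead (f : Lbs k par) (w : FreeSemigroup X) : Prop :=
  f - leftNormed k par w ∈ below k par deg w

theorem leftNormed_mem_below {v w : FreeSemigroup X} (h : wt deg v < wt deg w) :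
    leftNormed k par v ∈ below k par deg w :=
  leftNormed_mem_wordSpan h

theorem below_mono {v w : FreeSemigroup X} (h : wt deg v ≤ wt deg w) :
    below k par deg v ≤ below k par deg w :=
  wordSpan_mono fun _ hu => lt_of_lt_of_le hu h

theorem HasLead.mem_below {f : Lbs k par} {v w : FreeSemigroup X} (hf : HasLead deg f v)
    (h : wt deg v < wt deg w) : f ∈ below k par deg w := by
  rw [← sub_add_cancel f (leftNormed k par v)]
  exact Submodule.add_mem _ (below_mono h.le hf) (leftNormed_mem_below h)

theorem coeff_eq_zero_of_mem_below {f : Lbs k par} {v w : FreeSemigroup X}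
    (hf : f ∈ below k par deg v) (h : wt deg v ≤ wt deg w) : coeff f w = 0 := by
  by_contra h'
  exact absurd (mem_wordSpan_iff.1 hf w (mem_supp.2 h')) (not_lt.2 h)

/-- Turns a maximum over the support into membership in a subspace, so that later arguments about
leading monomials become linear algebra. -/
theorem lead_eq_coe_iff {f : Lbs k par} {w : FreeSemigroup X} :
    lead deg f = w ↔ coeff f w ≠ 0 ∧ f - coeff f w • leftNormed k par w ∈ below k par deg w := by
  let _ := degLenLex deg
  have hle : ∀ v w : FreeSemigroup X, v ≤ w ↔ wt deg v ≤ wt deg w := fun _ _ => Iff.rfl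
  change (supp f).max = w ↔ _
  constructor
  · intro h
    have hw := mem_supp.1 (Finset.mem_of_max h)
    refine ⟨hw, mem_wordSpan_iff.2 fun v hv => ?_⟩
    rw [mem_supp, coeff_sub, coeff_smul] at hv
    by_cases hvw : w = v
    · subst hvw
      simp [coeff_leftNormed_self] at hv
    · rw [coeff_leftNormed_of_ne hvw, mul_zero, sub_zero] at hv
      have := (hle _ _).1 (Finset.le_max_of_eq (mem_supp.2 hv) h)
      exact lt_of_le_of_ne this fun e => hvw (wt_injective deg e).symm
  · rintro ⟨hw, h⟩
    refine le_antisymm (Finset.max_le fun v hv => ?_) (Finset.le_max (mem_supp.2 hw))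
    rw [WithBot.coe_le_coe, hle]
    by_contra! hlt
    have h0 := coeff_eq_zero_of_mem_below h hlt.le
    rw [coeff_sub, coeff_smul, coeff_leftNormed_of_ne, mul_zero, sub_zero] at h0
    · exact mem_supp.1 hv h0
    · rintro rfl
      exact lt_irrefl _ hlt

theorem exists_lead_eq {f : Lbs k par} (hf : f ≠ 0) : ∃ w : FreeSemigroup X, lead deg f = w := by
  let _ := degLenLex deg
  have h : (supp f).Nonempty := by
    rw [supp, Finsupp.support_nonempty_iff]
    simpa using hf
  exact ⟨_, (Finset.coe_max' h).symm⟩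

theorem HasLead.coeff_eq_one {f : Lbs k par} {w : FreeSemigroup X} (h : HasLead deg f w) :
    coeff f w = 1 := by
  have := coeff_eq_zero_of_mem_below h le_rfl
  rwa [coeff_sub, coeff_leftNormed_self, sub_eq_zero] at this

theorem HasLead.lead_eq {f : Lbs k par} {w : FreeSemigroup X} (h : HasLead deg f w) :
    lead deg f = w := by
  rw [lead_eq_coe_iff, h.coeff_eq_one, one_smul]
  exact ⟨one_ne_zero, h⟩

theorem IsMonic.exists_hasLead {f : Lbs k par} (h : f.IsMonic deg) : ∃ w, HasLead deg f w := by
  obtain ⟨w, hw, h1⟩ := h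
  have := (lead_eq_coe_iff.1 hw).2
  rw [h1, one_smul] at this
  exact ⟨w, this⟩

theorem HasLead.unique {f : Lbs k par} {v w : FreeSemigroup X} (hv : HasLead deg f v)
    (hw : HasLead deg f w) : v = w :=
  WithBot.coe_injective (hv.lead_eq.symm.trans hw.lead_eq)

theorem HasLead.leadDeg_eq {f : Lbs k par} {w : FreeSemigroup X} (h : HasLead deg f w) :
    leadDeg deg f = wordDeg deg w := by
  rw [leadDeg, h.lead_eq]
  rfl

theorem HasLead.leadLength_eq {f : Lbs k par} {w : FreeSemigroup X} (h : HasLead deg f w) :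
    leadLength deg f = w.length := by
  rw [leadLength, h.lead_eq]
  rfl

theorem leadLT_iff {f g : Lbs k par} {v w : FreeSemigroup X} (hf : lead deg f = v)
    (hg : lead deg g = w) : LeadLT deg f g ↔ wt deg v < wt deg w := by
  let _ := degLenLex deg
  change lead deg f < lead deg g ↔ v < w
  rw [hf, hg, WithBot.coe_lt_coe]

theorem degLE_le_below {n : ℕ} {w : FreeSemigroup X} (h : n < wordDeg deg w) :
    degLE k par deg n ≤ below k par deg w :=
  wordSpan_mono fun _ hv => wt_lt_of_wordDeg_lt (lt_of_le_of_lt hv h)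

theorem HasLead.mem_degLE {f : Lbs k par} {w : FreeSemigroup X} (hf : HasLead deg f w) :
    f ∈ degLE k par deg (wordDeg deg w) := by
  rw [← sub_add_cancel f (leftNormed k par w)]
  exact Submodule.add_mem _ (wordSpan_mono (fun _ h => wordDeg_le_of_wt_lt h) hf)
    (leftNormed_mem_degLE w)

theorem mem_degLE_of_lead_eq {f : Lbs k par} {w : FreeSemigroup X} {n : ℕ}
    (hf : f ∈ degLE k par deg n) (h : lead deg f = w) : wordDeg deg w ≤ n :=
  mem_wordSpan_iff.1 hf w (mem_supp.2 (lead_eq_coe_iff.1 h).1)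

theorem mulLetters_mem_below {f : Lbs k par} {w : FreeSemigroup X} (hf : f ∈ below k par deg w)
    (l : List X) : mulLetters f l ∈ below k par deg (appendWord w l) :=
  mulLetters_mem l (fun _ hv => leftNormed_mem_below (wt_appendWord_lt hv l)) hf

theorem HasLead.mulLetters {f : Lbs k par} {w : FreeSemigroup X} (hf : HasLead deg f w)
    (l : List X) : HasLead deg (mulLetters f l) (appendWord w l) := by
  rw [HasLead, ← mulLetters_leftNormed, ← mulLetters_sub]
  exact mulLetters_mem_below hf l

theorem leftNormed_mul_mem_below {f : Lbs k par} {a : X} (u : FreeSemigroup X)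
    (hf : f ∈ below k par deg (.of a)) :
    leftNormed k par u * f ∈ below k par deg (appendWord u [a]) := by
  refine mul_mem_of_wordSpan_right (fun v hv => ?_) hf
  rcases wt_lt_of_iff.1 hv with h | ⟨b, rfl, hb, hd⟩
  · refine degLE_le_below (n := wordDeg deg u + wordDeg deg v) ?_ 
      (mul_mem_degLE (leftNormed_mem_degLE u) (leftNormed_mem_degLE v))
    simpa [wordDeg_appendWord] using h
  · rw [leftNormed_of, leftNormed_mul_of]
    exact leftNormed_mem_below (wt_appendWord_letter_lt u hb hd)

theorem HasLead.leftNormed_mul {f : Lbs k par} {a : X} (hf : HasLead deg f (.of a))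
    (u : FreeSemigroup X) : HasLead deg (leftNormed k par u * f) (appendWord u [a]) := by
  rw [HasLead, ← leftNormed_mul_of, ← leftNormed_of, ← mul_sub]
  exact leftNormed_mul_mem_below u hf

/-! ### Normal polynomials -/

section Normal

variable {S : Set (Lbs k par)}

theorem hasLead_of_leadLength_eq_one {s : Lbs k par} {w : FreeSemigroup X} (h : HasLead deg s w)
    (h1 : leadLength deg s = 1) : ∃ a, w = .of a := by
  rw [h.leadLength_eq, length_eq_length_letters] at h1
  obtain ⟨a, ha⟩ := List.length_eq_one_iff.1 h1
  exact ⟨a, letters_injective ha⟩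

theorem HasLead.leadLength_of {s : Lbs k par} {a : X} (h : HasLead deg s (.of a)) :
    leadLength deg s = 1 :=
  h.leadLength_eq

theorem IsNormalPoly.mulLetters {p : Lbs k par} (hp : IsNormalPoly deg S p) (l : List X) :
    IsNormalPoly deg S (mulLetters p l) := by
  obtain ⟨s, hs, h⟩ := hp
  refine ⟨s, hs, ?_⟩
  cases h with
  | right l' => rw [← mulLetters_append]; exact .right _
  | middle h1 u l' => rw [← mulLetters_append]; exact .middle h1 _ _

theorem isNormalPoly_of_mem {s : Lbs k par} (hs : s ∈ S) : IsNormalPoly deg S s :=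
  ⟨s, hs, .right []⟩

theorem isNormalPoly_leftNormed_mul {s : Lbs k par} (hs : s ∈ S) {a : X}
    (ha : HasLead deg s (.of a)) (u : FreeSemigroup X) :
    IsNormalPoly deg S (leftNormed k par u * s) :=
  ⟨s, hs, .middle ha.leadLength_of u []⟩

/-- A normal polynomial is monic, and its leading monomial is as expected. -/
theorem IsNormal.cases_hasLead {s h : Lbs k par} {w : FreeSemigroup X} (hs : HasLead deg s w)
    (hn : IsNormal deg s h) :
    (∃ l, h = Lbs.mulLetters s l ∧ HasLead deg h (appendWord w l)) ∨
    (∃ a u l, w = .of a ∧ h = Lbs.mulLetters (leftNormed k par u * s) l ∧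
      HasLead deg h (appendWord u (a :: l))) := by
  cases hn with
  | right l => exact .inl ⟨l, rfl, hs.mulLetters l⟩
  | middle h1 u l =>
    obtain ⟨a, rfl⟩ := hasLead_of_leadLength_eq_one hs h1
    exact .inr ⟨a, u, l, rfl, rfl, by simpa using (hs.leftNormed_mul u).mulLetters l⟩

theorem IsNormalPoly.exists_hasLead (hS : ∀ s ∈ S, ∃ w, HasLead deg s w)
    {p : Lbs k par} (hp : IsNormalPoly deg S p) : ∃ w, HasLead deg p w := by
  obtain ⟨s, hs, h⟩ := hp
  obtain ⟨w, hw⟩ := hS s hs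
  rcases h.cases_hasLead hw with ⟨l, -, h⟩ | ⟨a, u, l, -, -, h⟩
  exacts [⟨_, h⟩, ⟨_, h⟩]

end Normal

variable {S : Set (Lbs k par)}

/-! ### Spans of normal polynomials -/

variable (deg S) in
/-- The span of the monic normal `S`-polynomials whose leading monomial lies in `t`. -/
noncomputable def normalSpan (t : Set (FreeSemigroup X)) : Submodule k (Lbs k par) :=
  Submodule.span k {p | IsNormalPoly deg S p ∧ ∃ v ∈ t, HasLead deg p v}

theorem IsNormalPoly.mem_normalSpan {t : Set (FreeSemigroup X)} {p : Lbs k par}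
    {v : FreeSemigroup X} (hp : IsNormalPoly deg S p) (hv : HasLead deg p v) (h : v ∈ t) :
    p ∈ normalSpan deg S t :=
  Submodule.subset_span ⟨hp, v, h, hv⟩

theorem normalSpan_le {t : Set (FreeSemigroup X)} {N : Submodule k (Lbs k par)}
    (h : ∀ p, IsNormalPoly deg S p → ∀ v ∈ t, HasLead deg p v → p ∈ N) :
    normalSpan deg S t ≤ N :=
  Submodule.span_le.2 (by rintro p ⟨hp, v, hv, hpv⟩; exact h p hp v hv hpv)

theorem normalSpan_mono {t t' : Set (FreeSemigroup X)} (h : t ⊆ t') :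
    normalSpan deg S t ≤ normalSpan deg S t' :=
  normalSpan_le fun _ hp _ hv hpv => hp.mem_normalSpan hpv (h hv)

theorem normalSpan_below_le (w : FreeSemigroup X) :
    normalSpan deg S {v | wt deg v < wt deg w} ≤ below k par deg w :=
  normalSpan_le fun _ _ _ hv hpv => hpv.mem_below hv

/-- Normal polynomials over a monic `S` are monic, so this notion of triviality and `TrivialBelow`
both become instances of `normalSpan`. -/
theorem trivialDeg_iff (hS : ∀ s ∈ S, ∃ w, HasLead deg s w) {n : ℕ} {f : Lbs k par} :
    TrivialDeg deg S n f ↔ f ∈ normalSpan deg S {v | wordDeg deg v ≤ n} := by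
  rw [TrivialDeg, normalSpan]
  refine Iff.of_eq (congrArg (fun t => f ∈ Submodule.span k t) (Set.ext fun p => ?_))
  refine and_congr_right fun hp => ⟨fun h => ?_, ?_⟩
  · obtain ⟨v, hv⟩ := hp.exists_hasLead hS
    exact ⟨v, hv.leadDeg_eq.symm.trans_le h, hv⟩
  · rintro ⟨v, h, hv⟩
    exact hv.leadDeg_eq.trans_le h

theorem trivialBelow_iff (hS : ∀ s ∈ S, ∃ w, HasLead deg s w) {f g : Lbs k par}
    {w : FreeSemigroup X} (hf : HasLead deg f w) :
    TrivialBelow deg S f g ↔ g ∈ normalSpan deg S {v | wt deg v < wt deg w} := by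
  rw [TrivialBelow, normalSpan]
  refine Iff.of_eq (congrArg (fun t => g ∈ Submodule.span k t) (Set.ext fun p => ?_))
  refine and_congr_right fun hp => ⟨fun h => ?_, ?_⟩
  · obtain ⟨v, hv⟩ := hp.exists_hasLead hS
    exact ⟨v, (leadLT_iff hv.lead_eq hf.lead_eq).1 h, hv⟩
  · rintro ⟨v, h, hv⟩
    exact (leadLT_iff hv.lead_eq hf.lead_eq).2 h

theorem mulLetters_mem_normalSpan {t t' : Set (FreeSemigroup X)} {f : Lbs k par} (l : List X)
    (hf : f ∈ normalSpan deg S t) (h : ∀ v ∈ t, appendWord v l ∈ t') :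
    mulLetters f l ∈ normalSpan deg S t' := by
  rw [← mulLettersMap_apply, ← Submodule.mem_comap]
  refine normalSpan_le (N := (normalSpan deg S t').comap (mulLettersMap k par l))
    (fun p hp v hv hpv => ?_) hf
  rw [Submodule.mem_comap, mulLettersMap_apply]
  exact (hp.mulLetters l).mem_normalSpan (hpv.mulLetters l) (h v hv)

theorem mulLetters_mem_normalSpan_below {f : Lbs k par} {w : FreeSemigroup X} (l : List X)
    (hf : f ∈ normalSpan deg S {v | wt deg v < wt deg w}) :
    mulLetters f l ∈ normalSpan deg S {v | wt deg v < wt deg (appendWord w l)} :=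
  mulLetters_mem_normalSpan l hf fun _ hv => wt_appendWord_lt hv l

theorem mul_of_mem_normalSpan_deg {n : ℕ} {f : Lbs k par} (a : X)
    (hf : f ∈ normalSpan deg S {v | wordDeg deg v ≤ n}) :
    f * of k par a ∈ normalSpan deg S {v | wordDeg deg v ≤ n + deg a} :=
  mulLetters_mem_normalSpan [a] hf fun v hv => by
    have hv : wordDeg deg v ≤ n := hv
    simpa [wordDeg_appendWord] using hv

/-- The same Leibniz induction as for gradings: right multiplication by letters keeps polynomials
normal. Since letters are permuted, only a degree bound survives, not a bound in the order. -/
theorem mul_leftNormed_mem_normalSpan (x : FreeSemigroup X) : ∀ {n : ℕ} {f : Lbs k par},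
    f ∈ normalSpan deg S {v | wordDeg deg v ≤ n} →
      f * leftNormed k par x ∈ normalSpan deg S {v | wordDeg deg v ≤ n + wordDeg deg x} := by
  induction x using word_induction with
  | of a =>
    intro n f hf
    rw [wordDeg_of]
    exact mul_of_mem_normalSpan_deg a hf
  | append x a ih =>
    intro n f hf
    have e : wordDeg deg (appendWord x [a]) = wordDeg deg x + deg a := by
      simp [wordDeg_appendWord]
    rw [← leftNormed_mul_of, ← leftNormed_of, leibniz_leftNormed, leftNormed_of, e]
    refine Submodule.sub_mem _ ?_ (Submodule.smul_mem _ _ ?_)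
    · rw [← add_assoc]
      exact mul_of_mem_normalSpan_deg a (ih hf)
    · rw [add_comm (wordDeg deg x), ← add_assoc]
      exact ih (mul_of_mem_normalSpan_deg a hf)

/-- The words of `g` of smaller degree than `a` are absorbed by the degree bound; the others are
smaller letters `b`, and `p * b` is again normal. -/
theorem IsNormalPoly.mul_mem_normalSpan {p g : Lbs k par} {v : FreeSemigroup X} {a : X}
    (hp : IsNormalPoly deg S p) (hv : HasLead deg p v) (hg : g ∈ below k par deg (.of a)) :
    p * g ∈ normalSpan deg S {u | wt deg u < wt deg (appendWord v [a])} := by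
  refine mul_mem_of_wordSpan_right (fun x hx => ?_) hg
  rcases wt_lt_of_iff.1 hx with h | ⟨b, rfl, hb, hd⟩
  · have hp' : p ∈ normalSpan deg S {u | wordDeg deg u ≤ wordDeg deg v} :=
      hp.mem_normalSpan hv (le_refl (wordDeg deg v))
    refine normalSpan_mono (fun u hu => ?_) (mul_leftNormed_mem_normalSpan x hp')
    have hu : wordDeg deg u ≤ wordDeg deg v + wordDeg deg x := hu
    refine wt_lt_of_wordDeg_lt ?_
    rw [wordDeg_appendWord, List.map_singleton, List.sum_singleton]
    omega
  · exact (hp.mulLetters [b]).mem_normalSpan (hv.mulLetters [b]) (wt_appendWord_letter_lt v hb hd)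

theorem mul_mem_normalSpan_of_mem {s f : Lbs k par} (hs : s ∈ S) {a : X}
    (ha : HasLead deg s (.of a)) {u : FreeSemigroup X} (hf : f ∈ below k par deg u) :
    f * s ∈ normalSpan deg S {v | wt deg v < wt deg (appendWord u [a])} :=
  wordSpan_le (N := (normalSpan deg S _).comap (LinearMap.mulRight k s))
    (fun v hv => (isNormalPoly_leftNormed_mul hs ha v).mem_normalSpan (ha.leftNormed_mul v)
      (wt_appendWord_lt hv [a])) hf

/-- Normal polynomials whose leading monomials share a prefix, but not the place where the element
of `S` is inserted, have a trivial difference. -/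
theorem IsNormalPoly.mul_of_sub_leftNormed_mul_mem {p s : Lbs k par} {v : FreeSemigroup X}
    (hp : IsNormalPoly deg S p) (hv : HasLead deg p v) (hs : s ∈ S) {a : X}
    (ha : HasLead deg s (.of a)) :
    p * of k par a - leftNormed k par v * s ∈
      normalSpan deg S {u | wt deg u < wt deg (appendWord v [a])} := by
  -- Both products are compared with `p * s`: one arises by replacing `s` by its leading letter, the
  -- other by replacing `p` by its leading word.
  have e : p * of k par a - leftNormed k par v * s =
      (p - leftNormed k par v) * s - p * (s - leftNormed k par (.of a)) := by
    rw [leftNormed_of]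
    simp only [sub_mul, mul_sub]
    abel
  rw [e]
  exact Submodule.sub_mem _ (mul_mem_normalSpan_of_mem hs ha hv) (hp.mul_mem_normalSpan hv ha)

/-- The case of disjoint insertions: `p` fills the prefix `v`, `s` fills the letter `a` further
right, and `l` lies in between. No composition is needed. -/
theorem IsNormalPoly.mulLetters_sub_mem {p s : Lbs k par} {v : FreeSemigroup X}
    (hp : IsNormalPoly deg S p) (hv : HasLead deg p v) (hs : s ∈ S) {a : X}
    (ha : HasLead deg s (.of a)) (l l' : List X) :
    Lbs.mulLetters p (l ++ a :: l') -
        Lbs.mulLetters (leftNormed k par (appendWord v l) * s) l' ∈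
      normalSpan deg S {u | wt deg u < wt deg (appendWord v (l ++ a :: l'))} := by
  have h := mulLetters_mem_normalSpan_below l'
    ((hp.mulLetters l).mul_of_sub_leftNormed_mul_mem (hv.mulLetters l) hs ha)
  simpa [mulLetters_sub, mulLetters_append] using h

/-! ### Left multiplication -/

/-- All left multiplications of elements of `S` are trivial. -/
def LeftTrivial (deg : X → ℕ+) (S : Set (Lbs k par)) : Prop :=
  ∀ s ∈ S, ∀ w, HasLead deg s w → ∀ μ : FreeSemigroup X,
    leftNormed k par μ * s ∈ normalSpan deg S {v | wordDeg deg v ≤ wordDeg deg μ + wordDeg deg w}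

/-- Composition (a) handles leading monomials of length above 1 with nonzero product. For length 1
the product is itself a normal polynomial, and a zero product is trivial. -/
theorem IsGroebnerShirshov.leftTrivial (hS : ∀ s ∈ S, ∃ w, HasLead deg s w)
    (h : IsGroebnerShirshov deg S) : LeftTrivial deg S := by
  intro s hs w hw μ
  by_cases h1 : leadLength deg s = 1
  · obtain ⟨a, rfl⟩ := hasLead_of_leadLength_eq_one hw h1
    refine (isNormalPoly_leftNormed_mul hs hw μ).mem_normalSpan (hw.leftNormed_mul μ) ?_
    simp [wordDeg_appendWord, wordDeg_of]
  · by_cases h0 : leftNormed k par μ * s = 0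
    · rw [h0]
      exact Submodule.zero_mem _
    · have hlen : 1 < leadLength deg s := by
        have : leadLength deg s = w.tail.length + 1 := hw.leadLength_eq
        omega
      rw [← hw.leadDeg_eq]
      exact (trivialDeg_iff hS).1 (h.1 s hs μ hlen h0)

/-- By Leibniz `μ(qa) = (μq)a ∓ (μa)q`. The second term needs the assumption on `q` for the longer
word `μa`, which is why it is required for all words at once; the sign requires `q` to have a
parity. -/
theorem leftNormed_mul_mulLetters_mem (l : List X) : ∀ {q : Lbs k par} {n : ℕ} {i : ZMod 2},
    q ∈ graded k par par i →
    (∀ μ : FreeSemigroup X, leftNormed k par μ * q ∈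
      normalSpan deg S {v | wordDeg deg v ≤ wordDeg deg μ + n}) →
    ∀ μ : FreeSemigroup X, leftNormed k par μ * mulLetters q l ∈
      normalSpan deg S {v | wordDeg deg v ≤
        wordDeg deg μ + (n + (l.map fun a => (deg a : ℕ)).sum)} := by
  induction l with
  | nil => intro q n i _ h μ; simpa using h μ
  | cons a l ih =>
    intro q n i hq h μ
    have hqa : q * of k par a ∈ graded k par par (i + par a) := by
      simpa using mulLetters_mem_graded hq [a]
    have ha : of k par a ∈ graded k par par (par a) := by
      simpa [wordSum_of, leftNormed_of] using
        leftNormed_mem_graded (k := k) (par := par) (φ := par) (.of a)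
    have := ih (n := n + deg a) hqa (fun μ => ?_) μ
    · simpa [add_assoc] using this
    · rw [leibniz_graded _ hq ha]
      refine Submodule.sub_mem _ ?_ (Submodule.smul_mem _ _ ?_)
      · rw [← add_assoc]
        exact mul_of_mem_normalSpan_deg a (h μ)
      · have e : wordDeg deg μ + (n + deg a) = wordDeg deg (appendWord μ [a]) + n := by
          rw [wordDeg_appendWord, List.map_singleton, List.sum_singleton]
          omega
        rw [leftNormed_mul_of, e]
        exact h _

/-- The trailing letters are removed by `leftNormed_mul_mulLetters_mem`. What is left is `μ * s`,
trivial by assumption, or `μ(us) = (μu)s ∓ (μs)u`. -/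
theorem LeftTrivial.mul_normal (hS : ∀ s ∈ S, ∃ w, HasLead deg s w)
    (hhom : ∀ s ∈ S, s.IsHomogeneous) (hL : LeftTrivial deg S) {p : Lbs k par}
    {w : FreeSemigroup X} (hp : IsNormalPoly deg S p) (hw : HasLead deg p w)
    (μ : FreeSemigroup X) : leftNormed k par μ * p ∈
      normalSpan deg S {v | wordDeg deg v ≤ wordDeg deg μ + wordDeg deg w} := by
  obtain ⟨s, hs, hn⟩ := hp
  obtain ⟨v, hv⟩ := hS s hs
  obtain ⟨i, hi⟩ := (hhom s hs).exists_mem_graded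
  rcases hn.cases_hasLead hv with ⟨l, rfl, h⟩ | ⟨a, u, l, rfl, rfl, h⟩
  · rw [hw.unique h, wordDeg_appendWord]
    exact leftNormed_mul_mulLetters_mem l hi (hL s hs v hv) μ
  · have e : wordDeg deg w =
        wordDeg deg u + deg a + (l.map fun a => (deg a : ℕ)).sum := by
      rw [hw.unique h, wordDeg_appendWord, List.map_cons, List.sum_cons, add_assoc]
    rw [e]
    have hu := leftNormed_mem_graded (k := k) (par := par) (φ := par) u
    refine leftNormed_mul_mulLetters_mem l (mul_mem_graded hu hi) (fun μ => ?_) μ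
    rw [leibniz_graded _ hu hi]
    refine Submodule.sub_mem _ ?_ (Submodule.smul_mem _ _ ?_)
    -- `μ * u` expands into words `x` of bounded degree, and each `x * s` is normal because `s` has
    -- a letter as leading monomial.
    · have hm := mul_mem_degLE (leftNormed_mem_degLE (k := k) (par := par) (deg := deg) μ)
        (leftNormed_mem_degLE (k := k) (par := par) (deg := deg) u)
      refine wordSpan_le (N := (normalSpan deg S _).comap (LinearMap.mulRight k s))
        (fun x hx => ?_) hm
      refine (isNormalPoly_leftNormed_mul hs hv x).mem_normalSpan (hv.leftNormed_mul x) ?_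
      have hx : wordDeg deg x ≤ wordDeg deg μ + wordDeg deg u := hx
      change wordDeg deg (appendWord x [a]) ≤ _
      rw [wordDeg_appendWord, List.map_singleton, List.sum_singleton]
      omega
    · have := mul_leftNormed_mem_normalSpan u (hL s hs _ hv μ)
      rwa [wordDeg_of, add_assoc, add_comm (deg a : ℕ)] at this

/-! ### Compositions -/

/-- Needed to multiply on the left an inclusion composition of two elements whose leading monomials
are the same letter. -/
theorem LeftTrivial.mul_mem_normalSpan_below (hS : ∀ s ∈ S, ∃ w, HasLead deg s w)
    (hhom : ∀ s ∈ S, s.IsHomogeneous) (hL : LeftTrivial deg S) {f : Lbs k par} {a : X}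
    (hf : f ∈ normalSpan deg S {v | wt deg v < wt deg (.of a)}) (u : FreeSemigroup X) :
    leftNormed k par u * f ∈ normalSpan deg S {v | wt deg v < wt deg (appendWord u [a])} := by
  refine normalSpan_le (N := (normalSpan deg S _).comap
    (LinearMap.mulLeft k (leftNormed k par u))) (fun p hp v hv hpv => ?_) hf
  rcases wt_lt_of_iff.1 hv with h | ⟨b, rfl, hb, hd⟩
  · refine normalSpan_mono (fun x hx => ?_) (hL.mul_normal hS hhom hp hpv u)
    have hx : wordDeg deg x ≤ wordDeg deg u + wordDeg deg v := hx
    refine wt_lt_of_wordDeg_lt ?_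
    rw [wordDeg_appendWord, List.map_singleton, List.sum_singleton]
    omega
  -- A normal polynomial whose leading monomial is one letter leaves no room for multiplications, so
  -- it is an element of `S`.
  · obtain ⟨s, hs, hn⟩ := hp
    obtain ⟨w, hw⟩ := hS s hs
    rcases hn.cases_hasLead hw with ⟨l, rfl, h⟩ | ⟨c, u', l, -, -, h⟩
    · have e := h.unique hpv
      cases l with
      | nil =>
        rw [appendWord_nil] at e
        subst e
        exact (isNormalPoly_leftNormed_mul hs hw u).mem_normalSpan (hw.leftNormed_mul u)
          (wt_appendWord_letter_lt u hb hd)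
      | cons c l => exact absurd e (appendWord_ne_of _ _ _ _)
    · exact absurd (h.unique hpv) (appendWord_ne_of _ _ _ _)

theorem IsGroebnerShirshov.inclusion_mem (hS : ∀ s ∈ S, ∃ w, HasLead deg s w)
    (h : IsGroebnerShirshov deg S) {s s' p : Lbs k par} {w : FreeSemigroup X} (hs : s ∈ S)
    (hs' : s' ∈ S) (hne : s ≠ s') (hw : HasLead deg s w) (hp : IsNormal deg s' p)
    (hpw : HasLead deg p w) : s - p ∈ normalSpan deg S {v | wt deg v < wt deg w} :=
  (trivialBelow_iff hS hw).1 (h.2 s hs s' hs' hne p hp (hw.lead_eq.trans hpw.lead_eq.symm))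

/-- This is the inclusion composition of `s` with `[s' l]_L`, multiplied on the right by `l'`.
Composition (b) requires distinct elements; if `s = s'`, equality of the leading monomials forces
`l` to be empty and the difference vanishes. -/
theorem IsGroebnerShirshov.right_sub_right_mem (hS : ∀ s ∈ S, ∃ w, HasLead deg s w)
    (h : IsGroebnerShirshov deg S) {s s' : Lbs k par} {v : FreeSemigroup X} (hs : s ∈ S)
    (hs' : s' ∈ S) (l : List X) (hw : HasLead deg s (appendWord v l)) (hv : HasLead deg s' v)
    (l' : List X) : mulLetters s l' - mulLetters s' (l ++ l') ∈
      normalSpan deg S {u | wt deg u < wt deg (appendWord v (l ++ l'))} := by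
  by_cases hne : s = s'
  · subst hne
    have e := congrArg letters (hw.unique hv)
    obtain rfl : l = [] := by simpa using e
    simp
  · have := mulLetters_mem_normalSpan_below l'
      (h.inclusion_mem hS hs hs' hne hw (.right l) (hv.mulLetters l))
    rwa [mulLetters_sub, ← mulLetters_append, appendWord_appendWord] at this

theorem IsGroebnerShirshov.right_sub_middle_mem (hS : ∀ s ∈ S, ∃ w, HasLead deg s w)
    (h : IsGroebnerShirshov deg S) {s s' : Lbs k par} {v u : FreeSemigroup X} {a : X}
    {l l' : List X} (hs : s ∈ S) (hs' : s' ∈ S) (hv : HasLead deg s v)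
    (ha : HasLead deg s' (.of a)) (e : appendWord v l = appendWord u (a :: l')) :
    mulLetters s l - mulLetters (leftNormed k par u * s') l' ∈
      normalSpan deg S {x | wt deg x < wt deg (appendWord v l)} := by
  have e' := congrArg letters e
  simp only [letters_appendWord] at e'
  -- Either the inserted letter `a` lies beyond `v`, or `v` extends `u` by `c`. In the second case
  -- an empty `c` still puts `a` just after `v`; only a nonempty `c` puts it inside `v` and calls
  -- for an inclusion composition.
  rcases List.append_eq_append_iff.1 e' with ⟨c, hu, rfl⟩ | ⟨c, hu, hl⟩
  · obtain rfl : u = appendWord v c := letters_injective hu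
    exact (isNormalPoly_of_mem hs).mulLetters_sub_mem hv hs' ha c l'
  · obtain rfl : v = appendWord u c := letters_injective hu
    cases c with
    | nil =>
      rw [List.nil_append] at hl
      subst hl
      rw [appendWord_nil] at hv ⊢
      simpa using (isNormalPoly_of_mem hs).mulLetters_sub_mem hv hs' ha [] l'
    | cons b c =>
      simp only [List.cons_append, List.cons.injEq] at hl
      obtain ⟨rfl, rfl⟩ := hl
      have hne : s ≠ s' := by
        rintro rfl
        exact appendWord_ne_of _ _ _ _ (hv.unique ha)
      have hp : HasLead deg (mulLetters (leftNormed k par u * s') c) (appendWord u (a :: c)) := by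
        simpa using (ha.leftNormed_mul u).mulLetters c
      have := mulLetters_mem_normalSpan_below l
        (h.inclusion_mem hS hs hs' hne hv (.middle ha.leadLength_of u c) hp)
      rwa [mulLetters_sub, ← mulLetters_append] at this

/-- Insertions at different letters are disjoint. At the same letter, the inclusion composition of
`s` and `s'` is multiplied on the left by `u`; here the inclusion case also relies on triviality of
left multiplications. -/
theorem IsGroebnerShirshov.middle_sub_middle_mem (hS : ∀ s ∈ S, ∃ w, HasLead deg s w)
    (hhom : ∀ s ∈ S, s.IsHomogeneous) (h : IsGroebnerShirshov deg S) {s s' : Lbs k par}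
    {u : FreeSemigroup X} {a b : X} {l l' c : List X} (hs : s ∈ S) (hs' : s' ∈ S)
    (ha : HasLead deg s (.of a)) (hb : HasLead deg s' (.of b)) (e : a :: l = c ++ b :: l') :
    mulLetters (leftNormed k par u * s) l -
        mulLetters (leftNormed k par (appendWord u c) * s') l' ∈
      normalSpan deg S {x | wt deg x < wt deg (appendWord u (a :: l))} := by
  cases c with
  | nil =>
    simp only [List.nil_append, List.cons.injEq] at e
    obtain ⟨rfl, rfl⟩ := e
    by_cases hne : s = s'
    · simp [hne]
    · have := mulLetters_mem_normalSpan_below l ((h.leftTrivial hS).mul_mem_normalSpan_below hS hhom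
        (h.inclusion_mem hS hs hs' hne ha (.right []) hb) u)
      simpa [mul_sub, mulLetters_sub] using this
  | cons d c =>
    simp only [List.cons_append, List.cons.injEq] at e
    obtain ⟨rfl, rfl⟩ := e
    have := (isNormalPoly_leftNormed_mul hs ha u).mulLetters_sub_mem (ha.leftNormed_mul u) hs' hb
      c l'
    simpa using this

/-- Over a Gröbner–Shirshov basis, the difference of two normal polynomials with the same leading
monomial is a combination of normal polynomials with smaller leading monomials. -/
theorem IsGroebnerShirshov.sub_mem (hS : ∀ s ∈ S, ∃ w, HasLead deg s w)
    (hhom : ∀ s ∈ S, s.IsHomogeneous) (h : IsGroebnerShirshov deg S) {p q : Lbs k par}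
    {w : FreeSemigroup X} (hp : IsNormalPoly deg S p) (hq : IsNormalPoly deg S q)
    (hpw : HasLead deg p w) (hqw : HasLead deg q w) :
    p - q ∈ normalSpan deg S {v | wt deg v < wt deg w} := by
  obtain ⟨s, hs, hn⟩ := hp
  obtain ⟨s', hs', hn'⟩ := hq
  obtain ⟨v, hv⟩ := hS s hs
  obtain ⟨v', hv'⟩ := hS s' hs'
  rcases hn.cases_hasLead hv with ⟨l, rfl, hl⟩ | ⟨a, u, l, rfl, rfl, hl⟩ <;>
    rcases hn'.cases_hasLead hv' with ⟨l', rfl, hl'⟩ | ⟨b, u', l', rfl, rfl, hl'⟩ <;>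
    obtain rfl := hpw.unique hl <;> have e := hqw.unique hl'
  · have e' := congrArg letters e
    simp only [letters_appendWord] at e'
    -- Both leading monomials are prefixes of the same word, so one is a prefix of the other;
    -- exchanging the roles only changes the sign.
    rcases List.append_eq_append_iff.1 e' with ⟨c, hu, rfl⟩ | ⟨c, hu, rfl⟩
    · obtain rfl : v' = appendWord v c := letters_injective hu
      rw [← neg_sub]
      exact Submodule.neg_mem _ (h.right_sub_right_mem hS hs' hs c hv' hv l')
    · obtain rfl : v = appendWord v' c := letters_injective hu
      rw [e]
      exact h.right_sub_right_mem hS hs hs' c hv hv' l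
  · exact h.right_sub_middle_mem hS hs hs' hv hv' e
  · rw [← neg_sub, e]
    exact Submodule.neg_mem _ (h.right_sub_middle_mem hS hs' hs hv' hv e.symm)
  · have e' := congrArg letters e
    simp only [letters_appendWord] at e'
    rcases List.append_eq_append_iff.1 e' with ⟨c, hu, hc⟩ | ⟨c, hu, hc⟩
    · obtain rfl : u' = appendWord u c := letters_injective hu
      exact h.middle_sub_middle_mem hS hhom hs hs' hv hv' hc
    · obtain rfl : u = appendWord u' c := letters_injective hu
      rw [← neg_sub, e]
      exact Submodule.neg_mem _ (h.middle_sub_middle_mem hS hhom hs' hs hv' hv hc)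

/-! ### Leading monomials of the elements of the ideal -/

/-- A combination is finite, so one element of `t` bounds all leading monomials used. This replaces
a strict bound, or no bound at all, by one suited to well-founded induction. -/
theorem exists_mem_normalSpan_le {t : Set (FreeSemigroup X)} {f : Lbs k par}
    (hf : f ∈ normalSpan deg S t) :
    f = 0 ∨ ∃ w ∈ t, f ∈ normalSpan deg S {v | wt deg v ≤ wt deg w} := by
  induction hf using Submodule.span_induction with
  | zero => exact .inl rfl
  | mem p hp =>
    obtain ⟨hp, v, hv, hpv⟩ := hp
    exact .inr ⟨v, hv, hp.mem_normalSpan hpv (le_refl (wt deg v))⟩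
  | smul c f _ ih =>
    rcases ih with rfl | ⟨w, hw, h⟩
    · exact .inl (smul_zero c)
    · exact .inr ⟨w, hw, Submodule.smul_mem _ _ h⟩
  | add f g _ _ ih ih' =>
    rcases ih with rfl | ⟨w, hw, h⟩
    · rwa [zero_add]
    rcases ih' with rfl | ⟨w', hw', h'⟩
    · rw [add_zero]
      exact .inr ⟨w, hw, h⟩
    right
    rcases le_total (wt deg w) (wt deg w') with hle | hle
    · exact ⟨w', hw', Submodule.add_mem _
        (normalSpan_mono (fun _ hv => le_trans hv hle) h) h'⟩
    · exact ⟨w, hw, Submodule.add_mem _ h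
        (normalSpan_mono (fun _ hv => le_trans hv hle) h')⟩

/-- The induction runs over the bound `w`, not over the leading monomial of `f`. By `sub_mem`, all
generators with leading monomial `w` may be replaced by a single `p`, so `f` is `c • p` plus smaller
generators. If `c ≠ 0`, then `f` has leading monomial `w`; if `c = 0`, the bound drops. -/
theorem IsGroebnerShirshov.exists_normal_of_mem_normalSpan [WellFoundedLT X]
    (hS : ∀ s ∈ S, ∃ w, HasLead deg s w) (hhom : ∀ s ∈ S, s.IsHomogeneous)
    (h : IsGroebnerShirshov deg S) (w : FreeSemigroup X) : ∀ f : Lbs k par,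
    f ∈ normalSpan deg S {v | wt deg v ≤ wt deg w} → f ≠ 0 →
      ∃ p, IsNormalPoly deg S p ∧ lead deg f = lead deg p := by
  induction w using (wellFounded_wt deg).induction with
  | _ w ih =>
    intro f hf hf0
    have hlt : f ∈ normalSpan deg S {v | wt deg v < wt deg w} →
        ∃ p, IsNormalPoly deg S p ∧ lead deg f = lead deg p := by
      intro hf
      obtain ⟨v, hv, hfv⟩ := (exists_mem_normalSpan_le hf).resolve_left hf0
      exact ih v hv f hfv hf0
    by_cases hw : ∃ p, IsNormalPoly deg S p ∧ HasLead deg p w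
    · obtain ⟨p, hp, hpw⟩ := hw
      have key : ∃ c : k, f - c • p ∈ normalSpan deg S {v | wt deg v < wt deg w} := by
        clear hf0 hlt
        induction hf using Submodule.span_induction with
        | zero => exact ⟨0, by simp⟩
        | mem q hq =>
          obtain ⟨hq, v, hv, hqv⟩ := hq
          rcases (show wt deg v ≤ wt deg w from hv).eq_or_lt with e | hv
          · obtain rfl := wt_injective deg e
            exact ⟨1, by rw [one_smul]; exact h.sub_mem hS hhom hq hp hqv hpw⟩
          · exact ⟨0, by simpa using hq.mem_normalSpan hqv hv⟩
        | smul c f _ ih =>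
          obtain ⟨d, hd⟩ := ih
          refine ⟨c * d, ?_⟩
          rw [mul_smul, ← smul_sub]
          exact Submodule.smul_mem _ _ hd
        | add f g _ _ ih ih' =>
          obtain ⟨c, hc⟩ := ih
          obtain ⟨d, hd⟩ := ih'
          refine ⟨c + d, ?_⟩
          rw [add_smul, add_sub_add_comm]
          exact Submodule.add_mem _ hc hd
      obtain ⟨c, hc⟩ := key
      by_cases hc0 : c = 0
      · exact hlt (by simpa [hc0] using hc)
      · have hb : f - c • leftNormed k par w ∈ below k par deg w := by
          have e : f - c • leftNormed k par w = (f - c • p) + c • (p - leftNormed k par w) := by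
            rw [smul_sub]
            abel
          rw [e]
          exact Submodule.add_mem _ (normalSpan_below_le w hc) (Submodule.smul_mem _ _ hpw)
        have hcoeff : coeff f w = c := by
          have := coeff_eq_zero_of_mem_below hb le_rfl
          rwa [coeff_sub, coeff_smul, coeff_leftNormed_self, mul_one, sub_eq_zero] at this
        refine ⟨p, hp, ?_⟩
        rw [hpw.lead_eq, lead_eq_coe_iff, hcoeff]
        exact ⟨hc0, hb⟩
    -- No normal polynomial has leading monomial `w`, so every generator is already strictly below
    -- it.
    · refine hlt (normalSpan_le (fun q hq v hv hqv => ?_) hf)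
      refine hq.mem_normalSpan hqv 
        (lt_of_le_of_ne (show wt deg v ≤ wt deg w from hv) fun e => hw ⟨q, hq, ?_⟩)
      rwa [← wt_injective deg e]

/-- The span of the normal polynomials is an ideal: stability on the left is `mul_normal`, stability
on the right is automatic from Leibniz. -/
theorem LeftTrivial.idealSpan_le (hS : ∀ s ∈ S, ∃ w, HasLead deg s w)
    (hhom : ∀ s ∈ S, s.IsHomogeneous) (hL : LeftTrivial deg S) :
    idealSpan k S ≤ normalSpan deg S Set.univ := by
  refine LeibnizSuper.idealSpan_le (k := k) (fun x y hy => ?_) fun s hs => ?_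
  · have hx : x ∈ wordSpan k par Set.univ := by
      rw [wordSpan_univ]
      exact Submodule.mem_top
    constructor
    · refine wordSpan_le (N := (normalSpan deg S _).comap (LinearMap.mulRight k y))
        (fun u _ => ?_) hx
      refine normalSpan_le (N := (normalSpan deg S _).comap
        (LinearMap.mulLeft k (leftNormed k par u))) (fun p hp v _ hpv => ?_) hy
      exact normalSpan_mono (Set.subset_univ _) (hL.mul_normal hS hhom hp hpv u)
    · refine wordSpan_le (N := (normalSpan deg S _).comap (LinearMap.mulLeft k y))
        (fun u _ => ?_) hx
      refine normalSpan_le (N := (normalSpan deg S _).comap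
        (LinearMap.mulRight k (leftNormed k par u))) (fun p hp v _ hpv => ?_) hy
      exact normalSpan_mono (Set.subset_univ _) (mul_leftNormed_mem_normalSpan u
        (hp.mem_normalSpan (t := {x | wordDeg deg x ≤ wordDeg deg v}) hpv
          (le_refl (wordDeg deg v))))
  · obtain ⟨w, hw⟩ := hS s hs
    exact (isNormalPoly_of_mem hs).mem_normalSpan hw trivial

theorem IsGroebnerShirshov.exists_normal [WellFoundedLT X]
    (hS : ∀ s ∈ S, ∃ w, HasLead deg s w) (hhom : ∀ s ∈ S, s.IsHomogeneous)
    (h : IsGroebnerShirshov deg S) {f : Lbs k par} (hf : f ∈ idealSpan k S) (hf0 : f ≠ 0) :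
    ∃ p, IsNormalPoly deg S p ∧ lead deg f = lead deg p := by
  obtain ⟨w, -, hw⟩ := (exists_mem_normalSpan_le
    ((h.leftTrivial hS).idealSpan_le hS hhom hf)).resolve_left hf0
  exact h.exists_normal_of_mem_normalSpan hS hhom w f hw hf0

/-! ### The converse: division inside the ideal. -/

theorem IsNormalPoly.mem_idealSpan {p : Lbs k par} (hp : IsNormalPoly deg S p) :
    p ∈ idealSpan k S := by
  have hmul : ∀ (l : List X) (f : Lbs k par), f ∈ idealSpan k S →
      Lbs.mulLetters f l ∈ idealSpan k S := by
    intro l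
    induction l with
    | nil => exact fun f hf => hf
    | cons a l ih => exact fun f hf => ih _ (idealSpan_isIdeal S _ f hf).2
  obtain ⟨s, hs, h⟩ := hp
  have hs := subset_idealSpan (k := k) S hs
  cases h with
  | right l => exact hmul l s hs
  | middle _ u l => exact hmul l _ (idealSpan_isIdeal S _ s hs).1

/-- If every leading monomial of the ideal is that of a normal polynomial, then every element of
the ideal is a combination of normal polynomials with leading monomials up to its own. -/
theorem mem_normalSpan_of_lead_eq [WellFoundedLT X] (hS : ∀ s ∈ S, ∃ w, HasLead deg s w)
    (h : ∀ f ∈ idealSpan k S, f ≠ 0 → ∃ p, IsNormalPoly deg S p ∧ lead deg f = lead deg p)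
    (w : FreeSemigroup X) : ∀ f ∈ idealSpan k S, lead deg f = w →
      f ∈ normalSpan deg S {v | wt deg v ≤ wt deg w} := by
  induction w using (wellFounded_wt deg).induction with
  | _ w ih =>
    intro f hf hfw
    obtain ⟨hc, hb⟩ := lead_eq_coe_iff.1 hfw
    have hf0 : f ≠ 0 := by
      rintro rfl
      simp [coeff] at hc
    obtain ⟨p, hp, hfp⟩ := h f hf hf0
    obtain ⟨v, hpv⟩ := hp.exists_hasLead hS
    obtain rfl : v = w := WithBot.coe_injective (hpv.lead_eq.symm.trans (hfp.symm.trans hfw))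
    have hpm : p ∈ normalSpan deg S {u | wt deg u ≤ wt deg v} :=
      hp.mem_normalSpan hpv (le_refl (wt deg v))
    rw [← sub_add_cancel f (coeff f v • p)]
    refine Submodule.add_mem _ ?_ (Submodule.smul_mem _ _ hpm)
    -- Subtracting `coeff f v • p` cancels the leading term and stays in the ideal, so the induction
    -- applies to the remainder.
    have hg : f - coeff f v • p ∈ below k par deg v := by
      have e : f - coeff f v • p = (f - coeff f v • leftNormed k par v) -
          coeff f v • (p - leftNormed k par v) := by
        rw [smul_sub]
        abel
      rw [e]
      exact Submodule.sub_mem _ hb (Submodule.smul_mem _ _ hpv)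
    by_cases hg0 : f - coeff f v • p = 0
    · rw [hg0]
      exact Submodule.zero_mem _
    obtain ⟨u, hu⟩ := exists_lead_eq (deg := deg) hg0
    have huv : wt deg u < wt deg v :=
      mem_wordSpan_iff.1 hg u (mem_supp.2 (lead_eq_coe_iff.1 hu).1)
    exact normalSpan_mono (fun x hx => le_trans hx huv.le) (ih u huv _
      (Submodule.sub_mem _ hf (Submodule.smul_mem _ _ hp.mem_idealSpan)) hu)

/-- Compositions lie in the ideal, so `mem_normalSpan_of_lead_eq` bounds them by their own leading
monomials. For (a), products do not exceed the sum of the degrees; for (b), the equal leading terms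
cancel. -/
theorem isGroebnerShirshov_of_exists_normal [WellFoundedLT X]
    (hS : ∀ s ∈ S, ∃ w, HasLead deg s w)
    (h : ∀ f ∈ idealSpan k S, f ≠ 0 → ∃ p, IsNormalPoly deg S p ∧ lead deg f = lead deg p) :
    IsGroebnerShirshov deg S := by
  refine ⟨fun s hs μ _ h0 => ?_, fun s hs s' hs' _ p hp e => ?_⟩
  · obtain ⟨w, hw⟩ := hS s hs
    obtain ⟨v, hv⟩ := exists_lead_eq (deg := deg) h0
    rw [trivialDeg_iff hS, hw.leadDeg_eq]
    have hv' := mem_degLE_of_lead_eq (mul_mem_degLE (leftNormed_mem_degLE μ) hw.mem_degLE) hv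
    exact normalSpan_mono (fun x hx => (wordDeg_le_of_wt_le hx).trans hv')
      (mem_normalSpan_of_lead_eq hS h v _
        (idealSpan_isIdeal S _ s (subset_idealSpan S hs)).1 hv)
  · obtain ⟨w, hw⟩ := hS s hs
    have hp : IsNormalPoly deg S p := ⟨s', hs', hp⟩
    obtain ⟨v, hv⟩ := hp.exists_hasLead hS
    obtain rfl : w = v := WithBot.coe_injective (hw.lead_eq.symm.trans (e.trans hv.lead_eq))
    rw [trivialBelow_iff hS hw]
    by_cases h0 : s - p = 0
    · rw [h0]
      exact Submodule.zero_mem _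
    obtain ⟨u, hu⟩ := exists_lead_eq (deg := deg) h0
    have hb : s - p ∈ below k par deg w := by
      rw [← sub_sub_sub_cancel_right s p (leftNormed k par w)]
      exact Submodule.sub_mem _ hw hv
    have huw : wt deg u < wt deg w :=
      mem_wordSpan_iff.1 hb u (mem_supp.2 (lead_eq_coe_iff.1 hu).1)
    exact normalSpan_mono (fun x hx => lt_of_le_of_lt hx huw) (mem_normalSpan_of_lead_eq hS h u _
      (Submodule.sub_mem _ (subset_idealSpan S hs) hp.mem_idealSpan) hu)

/-! ### Irreducible monomials -/

/-- A reducible word is `p - (p - w)` with `p` normal and `p - w` made of smaller words. The bound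
by `w` is kept so that reducing the tail of a polynomial cannot disturb its leading term. -/
theorem leftNormed_mem_irr_sup_ideal [WellFoundedLT X] (hS : ∀ s ∈ S, ∃ w, HasLead deg s w)
    (w : FreeSemigroup X) : leftNormed k par w ∈
      wordSpan k par {v | v ∈ Irr deg S ∧ wt deg v ≤ wt deg w} ⊔ idealSpan k S := by
  induction w using (wellFounded_wt deg).induction with
  | _ w ih =>
    by_cases hw : w ∈ Irr deg S
    · exact Submodule.mem_sup_left (leftNormed_mem_wordSpan ⟨hw, le_rfl⟩)
    · simp only [Irr, Set.mem_ofPred_eq, not_forall, not_not] at hw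
      obtain ⟨p, hp, hpw⟩ := hw
      obtain ⟨v, hv⟩ := hp.exists_hasLead hS
      obtain rfl : v = w := WithBot.coe_injective (hv.lead_eq.symm.trans hpw)
      rw [← sub_sub_cancel p (leftNormed k par v)]
      refine Submodule.sub_mem _ (Submodule.mem_sup_right hp.mem_idealSpan) ?_
      refine wordSpan_le (fun u hu => ?_) hv
      refine wordSpan_sup_mono (fun x hx => ?_) (ih u hu)
      exact ⟨hx.1, hx.2.trans (le_of_lt hu)⟩

theorem span_mkQ_irr_eq_top [WellFoundedLT X] (hS : ∀ s ∈ S, ∃ w, HasLead deg s w) :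
    Submodule.span k (Set.range fun w : Irr deg S =>
      (idealSpan k S).mkQ (leftNormed k par w)) = ⊤ := by
  have hr : (Set.range fun w : Irr deg S => (idealSpan k S).mkQ (leftNormed k par w)) =
      (idealSpan k S).mkQ '' (leftNormed k par '' Irr deg S) := by
    ext x
    simp
  rw [hr, Submodule.span_image, eq_top_iff, ← Submodule.range_mkQ (idealSpan k S),
    LinearMap.range_eq_map, ← span_leftNormed, Submodule.map_le_iff_le_comap, Submodule.span_le]
  rintro _ ⟨w, rfl⟩
  rw [SetLike.mem_coe, Submodule.comap_map_eq, Submodule.ker_mkQ]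
  exact wordSpan_sup_mono (fun _ h => h.1) (leftNormed_mem_irr_sup_ideal hS w)

/-- The words are independent before passing to the quotient, so their images are independent
exactly when their span meets the kernel trivially. -/
theorem linearIndependent_mkQ_irr_iff :
    LinearIndependent k (fun w : Irr deg S => (idealSpan k S).mkQ (leftNormed k par w)) ↔
      Disjoint (wordSpan k par (Irr deg S)) (idealSpan k S) := by
  have hli : LinearIndependent k (fun w : Irr deg S => leftNormed k par w) :=
    linearIndependent_leftNormed.comp _ Subtype.val_injective
  have hr : wordSpan k par (Irr deg S) =
      Submodule.span k (Set.range fun w : Irr deg S => leftNormed k par w) := by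
    rw [wordSpan, Set.image_eq_range]
  have hk := Submodule.ker_mkQ (idealSpan k S)
  rw [hr]
  refine ⟨fun h => ?_, fun h => hli.map (f := (idealSpan k S).mkQ) (by rwa [hk])⟩
  rw [← hk]
  exact Submodule.range_ker_disjoint (f := (idealSpan k S).mkQ) h

/-- An element of the span of `Irr(S)` has an irreducible leading monomial, which (ii) forbids for
nonzero elements of the ideal. Conversely, if `f` in the ideal has irreducible leading monomial `w`,
reducing its tail gives an element of the ideal in the span of `Irr(S)` with the same nonzero
coefficient at `w`. -/
theorem exists_normal_iff_disjoint [WellFoundedLT X] (hS : ∀ s ∈ S, ∃ w, HasLead deg s w) :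
    (∀ f ∈ idealSpan k S, f ≠ 0 → ∃ p, IsNormalPoly deg S p ∧ lead deg f = lead deg p) ↔
      Disjoint (wordSpan k par (Irr deg S)) (idealSpan k S) := by
  rw [Submodule.disjoint_def]
  constructor
  · intro h f hf hfI
    by_contra h0
    obtain ⟨w, hw⟩ := exists_lead_eq (deg := deg) h0
    obtain ⟨p, hp, e⟩ := h f hfI h0
    exact mem_wordSpan_iff.1 hf w (mem_supp.2 (lead_eq_coe_iff.1 hw).1) p hp (e.symm.trans hw)
  · intro h f hfI h0
    by_contra hp
    obtain ⟨w, hw⟩ := exists_lead_eq (deg := deg) h0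
    obtain ⟨hc, hb⟩ := lead_eq_coe_iff.1 hw
    have hirr : w ∈ Irr deg S := fun p hn e => hp ⟨p, hn, hw.trans e.symm⟩
    have hb' : f - coeff f w • leftNormed k par w ∈
        wordSpan k par {v | v ∈ Irr deg S ∧ wt deg v < wt deg w} ⊔ idealSpan k S := by
      refine wordSpan_le (fun u hu => ?_) hb
      exact wordSpan_sup_mono (fun x hx => ⟨hx.1, lt_of_le_of_lt hx.2 hu⟩)
        (leftNormed_mem_irr_sup_ideal hS u)
    obtain ⟨g, hg, i, hi, e⟩ := Submodule.mem_sup.1 hb'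
    have h1 : coeff f w • leftNormed k par w + g ∈ wordSpan k par (Irr deg S) :=
      Submodule.add_mem _ (Submodule.smul_mem _ _ (leftNormed_mem_wordSpan hirr))
        (wordSpan_mono (fun _ h => h.1) hg)
    have h2 : coeff f w • leftNormed k par w + g = f - i := by
      rw [eq_sub_iff_add_eq, add_assoc, e]
      abel
    have h3 := h _ h1 (h2 ▸ Submodule.sub_mem _ hfI hi)
    have h4 := congrArg (fun f => coeff f w) h3
    have hg0 : coeff g w = 0 :=
      coeff_eq_zero_of_mem_below (wordSpan_mono (fun _ h => h.2) hg) le_rfl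
    rw [coeff_add, coeff_smul, coeff_leftNormed_self, hg0, mul_one, add_zero] at h4
    exact hc (by simpa [coeff] using h4)

end Lbs

end LeibnizSuper

/-! ### The three equivalent conditions. -/

theorem theorem3 {k X : Type*} [Field k] [LinearOrder X] [WellFoundedLT X]
    (par : X → ZMod 2) (deg : X → ℕ+)
    (S : Set (LeibnizSuper.Lbs k par)) (hne : S.Nonempty)
    (hmonic : ∀ s ∈ S, s.IsMonic deg) (hhom : ∀ s ∈ S, s.IsHomogeneous) :
    List.TFAE [
      LeibnizSuper.Lbs.IsGroebnerShirshov deg S,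
      ∀ f ∈ LeibnizSuper.idealSpan k S, f ≠ 0 →
        ∃ h, LeibnizSuper.Lbs.IsNormalPoly deg S h ∧ f.lead deg = h.lead deg,
      LinearIndependent k (fun w : LeibnizSuper.Lbs.Irr deg S =>
          (LeibnizSuper.idealSpan k S).mkQ (LeibnizSuper.Lbs.leftNormed k par w)) ∧
        Submodule.span k (Set.range (fun w : LeibnizSuper.Lbs.Irr deg S =>
          (LeibnizSuper.idealSpan k S).mkQ (LeibnizSuper.Lbs.leftNormed k par w))) = ⊤] := by
  have hS : ∀ s ∈ S, ∃ w, LeibnizSuper.Lbs.HasLead deg s w :=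
    fun s hs => (hmonic s hs).exists_hasLead
  tfae_have 1 → 2 := fun h f hf hf0 => h.exists_normal hS hhom hf hf0
  tfae_have 2 → 1 := LeibnizSuper.Lbs.isGroebnerShirshov_of_exists_normal hS
  tfae_have 2 ↔ 3 := by
    rw [LeibnizSuper.Lbs.exists_normal_iff_disjoint hS,
      ← LeibnizSuper.Lbs.linearIndependent_mkQ_irr_iff]
    -- The spanning half of (iii) holds for every monic `S`, so only linear independence carries
    -- content.
    exact (and_iff_left (LeibnizSuper.Lbs.span_mkQ_irr_eq_top hS)).symm
  tfae_finish
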